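/- All algebras are associative complex algebras, not necessarily unital. $\mathcal A\sqcup\mathcal B$ is the free product (the coproduct in the category of algebras), with embeddings $i_1,i_2$; for homomorphisms $f,g$ with common target, $f\sqcup g$ is the homomorphism on the free product that they induce, and $j_1\amalg j_2=(i_1\circ j_1)\sqcup(i_2\circ j_2)$. A *$\odot$-independence* is a product assigning to linear functionals $\varphi_1$ on $\mathcal A_1$ and $\varphi_2$ on $\mathcal A_2$ (for all algebras $\mathcal A_1,\mathcal A_2$) a linear functional $\varphi_1\odot\varphi_2$ on $\mathcal A_1\sqcup\mathcal A_2$ such that $(\varphi_1\odot\varphi_2)\circ i_{1/2}=\varphi_{1/2}$, $(\varphi_1\odot\varphi_2)\odot\varphi_3=\varphi_1\odot(\varphi_2\odot\varphi_3)$, and $(\varphi_1\circ j_1)\odot(\varphi_2\circ j_2)=(\varphi_1\odot\varphi_2)\circ(j_1\amalg j_2)$ for algebra homomorphisms $j_1,j_2$. A linear functional $\varphi$ on a $*$-algebra $\mathcal A$ is *conditionally positive* if it is hermitian and $\varphi(a^*a)\ge 0$ for all $a\in\mathcal A$; it is a *state* if its normalized linear extension $\tilde\varphi(c\mathbf 1+a)=c+\varphi(a)$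 to $\mathbb C\mathbf 1\oplus\mathcal A$ satisfies $\tilde\varphi(x^*x)\ge0$ for all $x$. The $\odot$-independence is *positive* if $\varphi_1\odot\varphi_2$ is a state whenever $\varphi_1,\varphi_2$ are states on $*$-algebras. A *dual semigroup* is a $*$-algebra $\mathcal B$ with a $*$-algebra homomorphism $\Delta:\mathcal B\to\mathcal B\sqcup\mathcal B$ such that $(\Delta\amalg\mathrm{id})\circ\Delta=(\mathrm{id}\amalg\Delta)\circ\Delta$ and $(0\sqcup\mathrm{id})\circ\Delta=\mathrm{id}=(\mathrm{id}\sqcup0)\circ\Delta$. Put $\varphi_1\star\varphi_2=(\varphi_1\odot\varphi_2)\circ\Delta$ for linear functionals on $\mathcal B$. Let $S(\mathcal B)$ be the symmetric tensor algebra of $\mathcal B$ (with unit), $S(\varphi):S(\mathcal B)\to\mathbb C$ the unital homomorphism extending $\varphi$, and $\sigma:\mathcal B\sqcup\mathcal B\to S(\mathcal B)\otimes S(\mathcal B)$ the linear map with $\varphi_1\odot\varphi_2=(S(\varphi_1)\otimes S(\varphi_2))\circ\sigma$ for all $\varphi_1,\varphi_2$. For a linear functional $\psi$ on $\mathcal B$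 let $D(\psi)(x)=\frac{d}{dt}S(t\psi)(x)|_{t=0}$, and let $\exp_\star\psi$ be the restriction to $\mathcal B$ of $\sum_{n\ge0}\frac1{n!}D(\psi)^{\star n}$, the convolution powers being taken with respect to the comultiplication of $S(\mathcal B)$ that extends $\sigma\circ\Delta$ to a unital algebra homomorphism, with counit $S(0)$. *Schoenberg correspondence holds on $\mathcal B$* if $\exp_\star\psi$ is a state for every conditionally positive $\psi$ on $\mathcal B$ and every positive $\odot$-independence. **Proposition.** Let $\mathcal B$ and $\mathcal C$ be dual semigroups and $\kappa:\mathcal C\to\mathcal B$ a $*$-algebra homomorphism (no compatibility with the comultiplications is required). Suppose that Schoenberg correspondence holds on $\mathcal B$. Then for every conditionally positive linear functional $\psi$ on $\mathcal B$ and every positive $\odot$-independence, the convolution exponentials $\varphi_t=\exp_\star(t(\psi\circ\kappa))$, $t\ge0$, on $\mathcal C$ are well defined (the map $\sigma$ exists, the series converges pointwise, and its sum is uniquely determined) and form a continuous convolution semigroup of states on $\mathcal C$: each $\varphi_t$ is a state, $\varphi_{s+t}=\varphi_s\star\varphi_t$ for all $s,t\ge0$, $\varphi_0=0$, and $\varphi_t(c)\to0$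 as $t\to0+$ for every $c\in\mathcal C$. -/

import Mathlib

open scoped TensorProduct ComplexOrder NNReal
open Filter Topology

universe u v w

/-! ## The free product of (not necessarily unital) complex algebras

The free product `A ⊔ B` is the coproduct in the category of associative, not necessarily unital
complex algebras. It is realised by generators and relations; its universal property is recorded in
`FreeProd.lift`, `FreeProd.lift_inl`, `FreeProd.lift_inr` and `FreeProd.hom_ext`. -/

/-- Formal expressions in elements of `A` and `B`. -/
inductive FreeProd.Pre (A : Type u) (B : Type v) : Type (max u v)
  | inl (a : A) : FreeProd.Pre A B
  | inr (b : B) : FreeProd.Pre A B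
  | add (x y : FreeProd.Pre A B) : FreeProd.Pre A B
  | mul (x y : FreeProd.Pre A B) : FreeProd.Pre A B
  | smul (c : ℂ) (x : FreeProd.Pre A B) : FreeProd.Pre A B

namespace FreeProd

section Basic

variable (A : Type u) (B : Type v)
  [NonUnitalRing A] [Module ℂ A] [NonUnitalRing B] [Module ℂ B]

/-- The relations: the laws of an associative complex algebra, and the two inclusions are algebra
homomorphisms. -/
inductive Rel : Pre A B → Pre A B → Prop
  | add_left (x x' y) : Rel x x' → Rel (.add x y) (.add x' y)
  | add_right (x y y') : Rel y y' → Rel (.add x y) (.add x y')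
  | mul_left (x x' y) : Rel x x' → Rel (.mul x y) (.mul x' y)
  | mul_right (x y y') : Rel y y' → Rel (.mul x y) (.mul x y')
  | smul_congr (c x x') : Rel x x' → Rel (.smul c x) (.smul c x')
  | add_assoc (x y z) : Rel (.add (.add x y) z) (.add x (.add y z))
  | add_comm (x y) : Rel (.add x y) (.add y x)
  | zero_add (x) : Rel (.add (.inl 0) x) x
  | smul_add (c x y) : Rel (.smul c (.add x y)) (.add (.smul c x) (.smul c y))
  | add_smul (c d x) : Rel (.smul (c + d) x) (.add (.smul c x) (.smul d x))
  | mul_smul (c d x) : Rel (.smul (c * d) x) (.smul c (.smul d x))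
  | one_smul (x) : Rel (.smul 1 x) x
  | zero_smul (x) : Rel (.smul 0 x) (.inl 0)
  | mul_assoc (x y z) : Rel (.mul (.mul x y) z) (.mul x (.mul y z))
  | left_distrib (x y z) : Rel (.mul x (.add y z)) (.add (.mul x y) (.mul x z))
  | right_distrib (x y z) : Rel (.mul (.add x y) z) (.add (.mul x z) (.mul y z))
  | smul_mul (c x y) : Rel (.mul (.smul c x) y) (.smul c (.mul x y))
  | mul_smul_comm (c x y) : Rel (.mul x (.smul c y)) (.smul c (.mul x y))
  | inl_add (a a') : Rel (.inl (a + a')) (.add (.inl a) (.inl a'))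
  | inl_smul (c a) : Rel (.inl (c • a)) (.smul c (.inl a))
  | inl_mul (a a') : Rel (.inl (a * a')) (.mul (.inl a) (.inl a'))
  | inr_add (b b') : Rel (.inr (b + b')) (.add (.inr b) (.inr b'))
  | inr_smul (c b) : Rel (.inr (c • b)) (.smul c (.inr b))
  | inr_mul (b b') : Rel (.inr (b * b')) (.mul (.inr b) (.inr b'))

end Basic

end FreeProd

/-- The free product `A ⊔ B` of two (not necessarily unital) complex algebras. -/
def FreeProd (A : Type u) (B : Type v)
    [NonUnitalRing A] [Module ℂ A] [NonUnitalRing B] [Module ℂ B] : Type (max u v) :=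
  Quot (FreeProd.Rel A B)

namespace FreeProd

section Ring

variable {A : Type u} {B : Type v}
  [NonUnitalRing A] [Module ℂ A] [NonUnitalRing B] [Module ℂ B]

instance : Zero (FreeProd A B) := ⟨Quot.mk _ (.inl 0)⟩

instance : Add (FreeProd A B) :=
  ⟨Quot.map₂ Pre.add (fun x _ _ h => .add_right x _ _ h) (fun _ _ y h => .add_left _ _ y h)⟩

instance : Mul (FreeProd A B) :=
  ⟨Quot.map₂ Pre.mul (fun x _ _ h => .mul_right x _ _ h) (fun _ _ y h => .mul_left _ _ y h)⟩

instance : SMul ℂ (FreeProd A B) :=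
  ⟨fun c => Quot.map (Pre.smul c) (fun _ _ h => .smul_congr c _ _ h)⟩

instance : AddCommMonoid (FreeProd A B) where
  add_assoc := by rintro ⟨x⟩ ⟨y⟩ ⟨z⟩; exact Quot.sound (.add_assoc x y z)
  zero_add := by rintro ⟨x⟩; exact Quot.sound (.zero_add x)
  add_zero := by
    rintro ⟨x⟩
    exact (Quot.sound (.add_comm x (.inl 0))).trans (Quot.sound (.zero_add x))
  add_comm := by rintro ⟨x⟩ ⟨y⟩; exact Quot.sound (.add_comm x y)
  nsmul := nsmulRec

theorem zero_smul_aux (x : FreeProd A B) : (0 : ℂ) • x = 0 := by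
  rcases x with ⟨x⟩; exact Quot.sound (.zero_smul x)

instance : Module ℂ (FreeProd A B) where
  one_smul := by rintro ⟨x⟩; exact Quot.sound (.one_smul x)
  mul_smul := by rintro c d ⟨x⟩; exact Quot.sound (.mul_smul c d x)
  smul_zero c := by
    refine (Quot.sound (.inl_smul c (0 : A))).symm.trans ?_
    rw [smul_zero]; rfl
  smul_add := by rintro c ⟨x⟩ ⟨y⟩; exact Quot.sound (.smul_add c x y)
  add_smul := by rintro c d ⟨x⟩; exact Quot.sound (.add_smul c d x)
  zero_smul := zero_smul_aux

instance : IsScalarTower ℂ (FreeProd A B) (FreeProd A B) :=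
  ⟨by rintro c ⟨x⟩ ⟨y⟩; exact Quot.sound (.smul_mul c x y)⟩

instance : SMulCommClass ℂ (FreeProd A B) (FreeProd A B) :=
  ⟨by rintro c ⟨x⟩ ⟨y⟩; exact (Quot.sound (.mul_smul_comm c x y)).symm⟩

instance : Neg (FreeProd A B) := ⟨fun x => (-1 : ℂ) • x⟩

instance : NonUnitalRing (FreeProd A B) where
  neg_add_cancel x := by
    change (-1 : ℂ) • x + x = 0
    conv_lhs => rw [← one_smul ℂ x, smul_smul, ← add_smul]
    simp
  zsmul := zsmulRec
  left_distrib := by rintro ⟨x⟩ ⟨y⟩ ⟨z⟩; exact Quot.sound (.left_distrib x y z)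
  right_distrib := by rintro ⟨x⟩ ⟨y⟩ ⟨z⟩; exact Quot.sound (.right_distrib x y z)
  zero_mul x := by
    have h := smul_mul_assoc (0 : ℂ) (0 : FreeProd A B) x
    rwa [zero_smul, zero_smul] at h
  mul_zero x := by
    have h := mul_smul_comm (0 : ℂ) x (0 : FreeProd A B)
    rwa [zero_smul, zero_smul] at h
  mul_assoc := by rintro ⟨x⟩ ⟨y⟩ ⟨z⟩; exact Quot.sound (.mul_assoc x y z)

/-- The natural embedding `i₁ : A → A ⊔ B`. -/
def inl : A →ₙₐ[ℂ] FreeProd A B where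
  toFun a := Quot.mk _ (.inl a)
  map_smul' c a := Quot.sound (.inl_smul c a)
  map_zero' := rfl
  map_add' a a' := Quot.sound (.inl_add a a')
  map_mul' a a' := Quot.sound (.inl_mul a a')

theorem mk_inr_zero : (Quot.mk (Rel A B) (.inr 0) : Quot (Rel A B)) = Quot.mk _ (.inl 0) := by
  have h : Quot.mk (Rel A B) (.inr ((0 : ℂ) • 0)) = Quot.mk _ (.smul 0 (.inr 0)) :=
    Quot.sound (Rel.inr_smul 0 0)
  rw [_root_.zero_smul] at h
  exact h.trans (Quot.sound (Rel.zero_smul _))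

/-- The natural embedding `i₂ : B → A ⊔ B`. -/
def inr : B →ₙₐ[ℂ] FreeProd A B where
  toFun b := Quot.mk _ (.inr b)
  map_smul' c b := Quot.sound (.inr_smul c b)
  map_zero' := mk_inr_zero
  map_add' b b' := Quot.sound (.inr_add b b')
  map_mul' b b' := Quot.sound (.inr_mul b b')

/-- Every element is obtained from `A` and `B` by sums, products and scalar multiples. -/
theorem induction {p : FreeProd A B → Prop} (h_inl : ∀ a, p (inl a)) (h_inr : ∀ b, p (inr b))
    (h_add : ∀ x y, p x → p y → p (x + y)) (h_mul : ∀ x y, p x → p y → p (x * y))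
    (h_smul : ∀ (c : ℂ) x, p x → p (c • x)) (x : FreeProd A B) : p x := by
  rcases x with ⟨x⟩
  induction x with
  | inl a => exact h_inl a
  | inr b => exact h_inr b
  | add x y hx hy => exact h_add _ _ hx hy
  | mul x y hx hy => exact h_mul _ _ hx hy
  | smul c x hx => exact h_smul c _ hx

end Ring

section Lift

variable {A : Type u} {B : Type v} {D : Type w}
  [NonUnitalRing A] [Module ℂ A] [NonUnitalRing B] [Module ℂ B]
  [NonUnitalRing D] [Module ℂ D] [IsScalarTower ℂ D D] [SMulCommClass ℂ D D]

/-- Evaluation of formal expressions in an algebra `D`. -/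
def evalPre (f : A →ₙₐ[ℂ] D) (g : B →ₙₐ[ℂ] D) : Pre A B → D
  | .inl a => f a
  | .inr b => g b
  | .add x y => evalPre f g x + evalPre f g y
  | .mul x y => evalPre f g x * evalPre f g y
  | .smul c x => c • evalPre f g x

theorem evalPre_rel (f : A →ₙₐ[ℂ] D) (g : B →ₙₐ[ℂ] D) {x y : Pre A B} (h : Rel A B x y) :
    evalPre f g x = evalPre f g y := by
  induction h <;> simp_all [evalPre, _root_.add_assoc, _root_.smul_add, _root_.add_smul,
    SemigroupAction.mul_smul, _root_.mul_assoc, mul_add, add_mul, smul_mul_assoc,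
    _root_.mul_smul_comm]
  exact _root_.add_comm _ _

/-- The homomorphism `f ⊔ g : A ⊔ B → D` given by `f : A → D` and `g : B → D`. -/
def lift (f : A →ₙₐ[ℂ] D) (g : B →ₙₐ[ℂ] D) : FreeProd A B →ₙₐ[ℂ] D where
  toFun := Quot.lift (evalPre f g) fun _ _ h => evalPre_rel f g h
  map_smul' c := by rintro ⟨x⟩; rfl
  map_zero' := map_zero f
  map_add' := by rintro ⟨x⟩ ⟨y⟩; rfl
  map_mul' := by rintro ⟨x⟩ ⟨y⟩; rfl

@[simp] theorem lift_inl (f : A →ₙₐ[ℂ] D) (g : B →ₙₐ[ℂ] D) (a : A) : lift f g (inl a) = f a := rfl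

@[simp] theorem lift_inr (f : A →ₙₐ[ℂ] D) (g : B →ₙₐ[ℂ] D) (b : B) : lift f g (inr b) = g b := rfl

end Lift

section Ext

variable {A : Type u} {B : Type v} {D : Type w}
  [NonUnitalRing A] [Module ℂ A] [NonUnitalRing B] [Module ℂ B]
  [NonUnitalRing D] [Module ℂ D]

/-- Uniqueness in the universal property of the free product. -/
theorem hom_ext {F G : FreeProd A B →ₙₐ[ℂ] D} (hl : ∀ a, F (inl a) = G (inl a))
    (hr : ∀ b, F (inr b) = G (inr b)) : F = G := by
  ext x
  induction x using FreeProd.induction with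
  | h_inl a => exact hl a
  | h_inr b => exact hr b
  | h_add x y hx hy => rw [map_add, map_add, hx, hy]
  | h_mul x y hx hy => rw [map_mul, map_mul, hx, hy]
  | h_smul c x hx => rw [map_smul, map_smul, hx]

end Ext

section Map

variable {A A' B B' E : Type*}
  [NonUnitalRing A] [Module ℂ A] [NonUnitalRing A'] [Module ℂ A']
  [NonUnitalRing B] [Module ℂ B] [NonUnitalRing B'] [Module ℂ B']
  [NonUnitalRing E] [Module ℂ E]

/-- `j₁ ⨿ j₂ = (i₁ ∘ j₁) ⊔ (i₂ ∘ j₂) : A ⊔ B → A' ⊔ B'`. -/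
def map (f : A →ₙₐ[ℂ] A') (g : B →ₙₐ[ℂ] B') : FreeProd A B →ₙₐ[ℂ] FreeProd A' B' :=
  lift (inl.comp f) (inr.comp g)

variable (A B E) in
/-- The canonical identification `(A ⊔ B) ⊔ E → A ⊔ (B ⊔ E)`. -/
def assoc : FreeProd (FreeProd A B) E →ₙₐ[ℂ] FreeProd A (FreeProd B E) :=
  lift (lift inl (inr.comp inl)) (inr.comp inr)

variable (A B E) in
/-- The inverse of `assoc`. -/
def assocInv : FreeProd A (FreeProd B E) →ₙₐ[ℂ] FreeProd (FreeProd A B) E :=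
  lift (inl.comp inl) (lift (inl.comp inr) inr)

theorem assocInv_assoc (x : FreeProd (FreeProd A B) E) : assocInv A B E (assoc A B E x) = x := by
  have h : (assocInv A B E).comp (assoc A B E) = NonUnitalAlgHom.id ℂ _ := by
    refine hom_ext (fun y => ?_) (fun _ => rfl)
    have h' : ((assocInv A B E).comp (assoc A B E)).comp inl = inl :=
      hom_ext (fun _ => rfl) (fun _ => rfl)
    exact DFunLike.congr_fun h' y
  exact DFunLike.congr_fun h x

theorem assoc_assocInv (x : FreeProd A (FreeProd B E)) : assoc A B E (assocInv A B E x) = x := by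
  have h : (assoc A B E).comp (assocInv A B E) = NonUnitalAlgHom.id ℂ _ := by
    refine hom_ext (fun _ => rfl) (fun y => ?_)
    have h' : ((assoc A B E).comp (assocInv A B E)).comp inr = inr :=
      hom_ext (fun _ => rfl) (fun _ => rfl)
    exact DFunLike.congr_fun h' y
  exact DFunLike.congr_fun h x

end Map

section Star

variable {A : Type u} {B : Type v}
  [NonUnitalRing A] [Module ℂ A] [StarRing A] [StarModule ℂ A]
  [NonUnitalRing B] [Module ℂ B] [StarRing B] [StarModule ℂ B]

/-- The involution on formal expressions. -/
def starPre : Pre A B → Pre A B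
  | .inl a => .inl (star a)
  | .inr b => .inr (star b)
  | .add x y => .add (starPre x) (starPre y)
  | .mul x y => .mul (starPre y) (starPre x)
  | .smul c x => .smul (star c) (starPre x)

theorem starPre_rel {x y : Pre A B} (h : Rel A B x y) : Rel A B (starPre x) (starPre y) ∨
    Rel A B (starPre y) (starPre x) := by
  induction h <;> simp only [starPre, star_add, star_mul, star_smul, star_zero, star_one]
  case add_left x x' y _ ih => exact ih.imp (Rel.add_left _ _ _) (Rel.add_left _ _ _)
  case add_right x x' y _ ih => exact ih.imp (Rel.add_right _ _ _) (Rel.add_right _ _ _)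
  case mul_left x x' y _ ih => exact ih.imp (Rel.mul_right _ _ _) (Rel.mul_right _ _ _)
  case mul_right x x' y _ ih => exact ih.imp (Rel.mul_left _ _ _) (Rel.mul_left _ _ _)
  case smul_congr c x x' _ ih => exact ih.imp (Rel.smul_congr _ _ _) (Rel.smul_congr _ _ _)
  case mul_assoc => exact Or.inr (Rel.mul_assoc _ _ _)
  case mul_smul c d x => exact Or.inl (by rw [mul_comm]; exact Rel.mul_smul _ _ _)
  all_goals left; constructor

/-- The involution of the free product of two `*`-algebras. -/
instance : StarRing (FreeProd A B) where
  star := Quot.lift (fun x => Quot.mk _ (starPre x)) fun _ _ h =>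
    (starPre_rel h).elim (fun h => Quot.sound h) (fun h => (Quot.sound h).symm)
  star_involutive := by
    rintro ⟨x⟩
    have h : ∀ x : Pre A B, starPre (starPre x) = x := by
      intro x
      induction x <;> simp_all [starPre]
    exact congrArg (Quot.mk _) (h x)
  star_mul := by rintro ⟨x⟩ ⟨y⟩; rfl
  star_add := by rintro ⟨x⟩ ⟨y⟩; rfl

instance : StarModule ℂ (FreeProd A B) := ⟨by rintro c ⟨x⟩; rfl⟩

@[simp] theorem star_inl (a : A) : star (inl a : FreeProd A B) = inl (star a) := rfl

@[simp] theorem star_inr (b : B) : star (inr b : FreeProd A B) = inr (star b) := rfl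

end Star

end FreeProd

/-! ## Independences -/

/-- A `⊙`-independence: a product of linear functionals on complex algebras with values in the
linear functionals on the free product, satisfying (A1), (A2) and (A3). -/
structure Independence : Type (u + 1) where
  /-- The product `φ₁ ⊙ φ₂`. -/
  prod : ∀ {A B : Type u}
    [NonUnitalRing A] [Module ℂ A] [IsScalarTower ℂ A A] [SMulCommClass ℂ A A]
    [NonUnitalRing B] [Module ℂ B] [IsScalarTower ℂ B B] [SMulCommClass ℂ B B],
    (A →ₗ[ℂ] ℂ) → (B →ₗ[ℂ] ℂ) → (FreeProd A B →ₗ[ℂ] ℂ)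
  /-- (A1), first embedding. -/
  prod_inl : ∀ {A B : Type u}
    [NonUnitalRing A] [Module ℂ A] [IsScalarTower ℂ A A] [SMulCommClass ℂ A A]
    [NonUnitalRing B] [Module ℂ B] [IsScalarTower ℂ B B] [SMulCommClass ℂ B B]
    (φ₁ : A →ₗ[ℂ] ℂ) (φ₂ : B →ₗ[ℂ] ℂ) (a : A), prod φ₁ φ₂ (FreeProd.inl a) = φ₁ a
  /-- (A1), second embedding. -/
  prod_inr : ∀ {A B : Type u}
    [NonUnitalRing A] [Module ℂ A] [IsScalarTower ℂ A A] [SMulCommClass ℂ A A]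
    [NonUnitalRing B] [Module ℂ B] [IsScalarTower ℂ B B] [SMulCommClass ℂ B B]
    (φ₁ : A →ₗ[ℂ] ℂ) (φ₂ : B →ₗ[ℂ] ℂ) (b : B), prod φ₁ φ₂ (FreeProd.inr b) = φ₂ b
  /-- (A2): `(φ₁ ⊙ φ₂) ⊙ φ₃ = φ₁ ⊙ (φ₂ ⊙ φ₃)` under `(A ⊔ B) ⊔ E ≅ A ⊔ (B ⊔ E)`. -/
  prod_assoc : ∀ {A B E : Type u}
    [NonUnitalRing A] [Module ℂ A] [IsScalarTower ℂ A A] [SMulCommClass ℂ A A]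
    [NonUnitalRing B] [Module ℂ B] [IsScalarTower ℂ B B] [SMulCommClass ℂ B B]
    [NonUnitalRing E] [Module ℂ E] [IsScalarTower ℂ E E] [SMulCommClass ℂ E E]
    (φ₁ : A →ₗ[ℂ] ℂ) (φ₂ : B →ₗ[ℂ] ℂ) (φ₃ : E →ₗ[ℂ] ℂ) (x : FreeProd (FreeProd A B) E),
    prod (prod φ₁ φ₂) φ₃ x = prod φ₁ (prod φ₂ φ₃) (FreeProd.assoc A B E x)
  /-- (A3): `(φ₁ ∘ j₁) ⊙ (φ₂ ∘ j₂) = (φ₁ ⊙ φ₂) ∘ (j₁ ⨿ j₂)`. -/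
  prod_comp : ∀ {A A' B B' : Type u}
    [NonUnitalRing A] [Module ℂ A] [IsScalarTower ℂ A A] [SMulCommClass ℂ A A]
    [NonUnitalRing A'] [Module ℂ A'] [IsScalarTower ℂ A' A'] [SMulCommClass ℂ A' A']
    [NonUnitalRing B] [Module ℂ B] [IsScalarTower ℂ B B] [SMulCommClass ℂ B B]
    [NonUnitalRing B'] [Module ℂ B'] [IsScalarTower ℂ B' B'] [SMulCommClass ℂ B' B']
    (φ₁ : A' →ₗ[ℂ] ℂ) (φ₂ : B' →ₗ[ℂ] ℂ) (j₁ : A →ₙₐ[ℂ] A') (j₂ : B →ₙₐ[ℂ] B'),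
    prod (φ₁ ∘ₗ (j₁ : A →ₗ[ℂ] A')) (φ₂ ∘ₗ (j₂ : B →ₗ[ℂ] B')) =
      prod φ₁ φ₂ ∘ₗ (FreeProd.map j₁ j₂ : FreeProd A B →ₗ[ℂ] FreeProd A' B')

/-! ## Conditionally positive functionals and states on `*`-algebras -/

section Positivity

variable {A : Type u} [NonUnitalRing A] [Module ℂ A] [StarRing A]

/-- Conditionally positive: hermitian, and `φ (a* a) ≥ 0` for all `a ∈ A`. -/
def IsCondPositive (φ : A →ₗ[ℂ] ℂ) : Prop :=
  (∀ a, φ (star a) = star (φ a)) ∧ ∀ a, 0 ≤ φ (star a * a)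

/-- The normalized linear extension `φ̃ (c 1 + a) = c + φ a` of `φ` to `Ã = ℂ 1 ⊕ A`. -/
def unitExt (φ : A →ₗ[ℂ] ℂ) (x : Unitization ℂ A) : ℂ := x.fst + φ x.snd

/-- State: the normalized linear extension `φ̃` to `Ã = ℂ 1 ⊕ A` is positive. -/
def IsState (φ : A →ₗ[ℂ] ℂ) : Prop :=
  ∀ x : Unitization ℂ A, 0 ≤ unitExt φ (star x * x)

end Positivity

/-- A `⊙`-independence is positive if the product of two states on `*`-algebras is a state. -/
def Independence.IsPositive (P : Independence.{u}) : Prop :=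
  ∀ {A B : Type u}
    [NonUnitalRing A] [Module ℂ A] [IsScalarTower ℂ A A] [SMulCommClass ℂ A A]
    [StarRing A] [StarModule ℂ A]
    [NonUnitalRing B] [Module ℂ B] [IsScalarTower ℂ B B] [SMulCommClass ℂ B B]
    [StarRing B] [StarModule ℂ B]
    (φ₁ : A →ₗ[ℂ] ℂ) (φ₂ : B →ₗ[ℂ] ℂ), IsState φ₁ → IsState φ₂ → IsState (P.prod φ₁ φ₂)

/-! ## Dual semigroups -/

/-- A dual semigroup: a `*`-algebra `B` with a `*`-algebra homomorphism `Δ : B → B ⊔ B` which is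
coassociative and has the zero homomorphism as counit. -/
class DualSemigroup (B : Type u)
    [NonUnitalRing B] [Module ℂ B] [IsScalarTower ℂ B B] [SMulCommClass ℂ B B]
    [StarRing B] [StarModule ℂ B] where
  /-- The comultiplication `Δ`. -/
  comul : B →⋆ₙₐ[ℂ] FreeProd B B
  /-- `(Δ ⨿ id) ∘ Δ = (id ⨿ Δ) ∘ Δ` under `(B ⊔ B) ⊔ B ≅ B ⊔ (B ⊔ B)`. -/
  coassoc : ∀ b : B,
    FreeProd.assoc B B B
        (FreeProd.map comul.toNonUnitalAlgHom (NonUnitalAlgHom.id ℂ B) (comul b)) =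
      FreeProd.map (NonUnitalAlgHom.id ℂ B) comul.toNonUnitalAlgHom (comul b)
  /-- `(0 ⊔ id) ∘ Δ = id`. -/
  counit_left : ∀ b : B, FreeProd.lift 0 (NonUnitalAlgHom.id ℂ B) (comul b) = b
  /-- `(id ⊔ 0) ∘ Δ = id`. -/
  counit_right : ∀ b : B, FreeProd.lift (NonUnitalAlgHom.id ℂ B) 0 (comul b) = b

/-! ## Convolution of functionals on a vector space with comultiplication and counit -/

section CoalgebraConvolution

variable {V : Type u} [AddCommGroup V] [Module ℂ V]

/-- `f ⋆ g = (f ⊗ g) ∘ Δ`. -/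
noncomputable def tensorConv (Δ : V →ₗ[ℂ] V ⊗[ℂ] V) (f g : V →ₗ[ℂ] ℂ) : V →ₗ[ℂ] ℂ :=
  LinearMap.mul' ℂ ℂ ∘ₗ TensorProduct.map f g ∘ₗ Δ

/-- The convolution powers `f ^ ⋆n`, with `f ^ ⋆0` the counit `δ`. -/
noncomputable def tensorConvPow (Δ : V →ₗ[ℂ] V ⊗[ℂ] V) (δ f : V →ₗ[ℂ] ℂ) : ℕ → (V →ₗ[ℂ] ℂ)
  | 0 => δ
  | n + 1 => tensorConv Δ (tensorConvPow Δ δ f n) f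

/-- The convolution exponential `exp_⋆ f = ∑ f ^ ⋆n / n!` converges at `x` with value `z`. -/
def HasTensorConvExpAt (Δ : V →ₗ[ℂ] V ⊗[ℂ] V) (δ f : V →ₗ[ℂ] ℂ) (x : V) (z : ℂ) : Prop :=
  HasSum (fun n : ℕ => ((n.factorial : ℂ))⁻¹ * tensorConvPow Δ δ f n x) z

end CoalgebraConvolution

/-! ## The symmetric tensor algebra and the convolution exponential on a dual semigroup -/

section SymmetricFunctionals

variable {V : Type u} [AddCommGroup V] [Module ℂ V]

theorem differentiable_symLift (ψ : V →ₗ[ℂ] ℂ) (x : SymmetricAlgebra ℂ V) :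
    Differentiable ℝ fun t : ℝ => SymmetricAlgebra.lift ((t : ℂ) • ψ) x := by
  induction x using SymmetricAlgebra.induction with
  | algebraMap r => simp only [AlgHom.commutes]; exact differentiable_const _
  | ι v =>
    simp only [SymmetricAlgebra.lift_ι_apply, LinearMap.smul_apply, smul_eq_mul]
    exact (Complex.ofRealCLM.differentiable).mul_const _
  | mul a b ha hb => simp only [map_mul]; exact ha.mul hb
  | add a b ha hb => simp only [map_add]; exact ha.add hb

/-- The linear functional `D(ψ)(x) = d/dt S(t ψ)(x) |_{t = 0}` on the symmetric tensor algebra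
`S(V)`, where `S(φ) : S(V) → ℂ` is the unital algebra homomorphism extending `φ : V → ℂ`. -/
noncomputable def symDeriv (ψ : V →ₗ[ℂ] ℂ) : SymmetricAlgebra ℂ V →ₗ[ℂ] ℂ where
  toFun x := deriv (fun t : ℝ => SymmetricAlgebra.lift ((t : ℂ) • ψ) x) 0
  map_add' x y := by
    simp only [map_add]
    exact deriv_fun_add (differentiable_symLift ψ x 0) (differentiable_symLift ψ y 0)
  map_smul' c x := by
    simp only [map_smul, RingHom.id_apply]
    exact deriv_fun_const_smul c (differentiable_symLift ψ x 0)

end SymmetricFunctionals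

namespace Independence

variable (P : Independence.{u})

/-- `σ : A ⊔ B → S(A) ⊗ S(B)` is a linear map with `φ₁ ⊙ φ₂ = (S(φ₁) ⊗ S(φ₂)) ∘ σ` for all linear
functionals `φ₁` on `A` and `φ₂` on `B`. -/
def IsSymbol {A B : Type u}
    [NonUnitalRing A] [Module ℂ A] [IsScalarTower ℂ A A] [SMulCommClass ℂ A A]
    [NonUnitalRing B] [Module ℂ B] [IsScalarTower ℂ B B] [SMulCommClass ℂ B B]
    (σ : FreeProd A B →ₗ[ℂ] SymmetricAlgebra ℂ A ⊗[ℂ] SymmetricAlgebra ℂ B) : Prop :=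
  ∀ (φ₁ : A →ₗ[ℂ] ℂ) (φ₂ : B →ₗ[ℂ] ℂ) (x : FreeProd A B),
    P.prod φ₁ φ₂ x =
      Algebra.TensorProduct.productMap (SymmetricAlgebra.lift φ₁) (SymmetricAlgebra.lift φ₂) (σ x)

variable {B : Type u}
  [NonUnitalRing B] [Module ℂ B] [IsScalarTower ℂ B B] [SMulCommClass ℂ B B]
  [StarRing B] [StarModule ℂ B] [DualSemigroup B]

/-- The convolution `φ₁ ⋆ φ₂ = (φ₁ ⊙ φ₂) ∘ Δ` of linear functionals on a dual semigroup. -/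
def conv (φ₁ φ₂ : B →ₗ[ℂ] ℂ) : B →ₗ[ℂ] ℂ :=
  P.prod φ₁ φ₂ ∘ₗ ((DualSemigroup.comul (B := B)).toNonUnitalAlgHom : B →ₗ[ℂ] FreeProd B B)

/-- The comultiplication `S(σ ∘ Δ) : S(B) → S(B) ⊗ S(B)`. -/
noncomputable def symComul
    (σ : FreeProd B B →ₗ[ℂ] SymmetricAlgebra ℂ B ⊗[ℂ] SymmetricAlgebra ℂ B) :
    SymmetricAlgebra ℂ B →ₐ[ℂ] SymmetricAlgebra ℂ B ⊗[ℂ] SymmetricAlgebra ℂ B :=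
  SymmetricAlgebra.lift
    (σ ∘ₗ ((DualSemigroup.comul (B := B)).toNonUnitalAlgHom : B →ₗ[ℂ] FreeProd B B))

/-- `φ = exp_⋆ ψ` on the dual semigroup `B`: the functional `φ` is the restriction to `B` of the
convolution exponential of `D(ψ)` on `S(B)` with the comultiplication `S(σ ∘ Δ)` and the counit
`S(0)`. The relation includes the existence of `σ` and the convergence of the exponential
series. -/
def IsConvExp (ψ φ : B →ₗ[ℂ] ℂ) : Prop :=
  ∃ σ : FreeProd B B →ₗ[ℂ] SymmetricAlgebra ℂ B ⊗[ℂ] SymmetricAlgebra ℂ B,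
    P.IsSymbol σ ∧ ∀ b : B,
      HasTensorConvExpAt (symComul σ).toLinearMap
        (SymmetricAlgebra.lift (0 : B →ₗ[ℂ] ℂ)).toLinearMap (symDeriv ψ)
        (SymmetricAlgebra.ι ℂ B b) (φ b)

/-- Continuous convolution semigroup of linear functionals on a dual semigroup: the counit of
`ℂ 1 ⊕ B` vanishes on `B`, so that `φ₀ = 0` and `φ_t → 0` point-wise for `t → 0+`. -/
structure IsCCSG (φ : ℝ≥0 → (B →ₗ[ℂ] ℂ)) : Prop where
  add : ∀ s t, φ (s + t) = P.conv (φ s) (φ t)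
  zero : φ 0 = 0
  tendsto : ∀ b, Tendsto (fun t => φ t b) (𝓝[>] 0) (𝓝 0)

end Independence

/-- Schoenberg correspondence holds on the dual semigroup `B`: for each positive `⊙`-independence
and each conditionally positive `ψ`, the convolution exponential `exp_⋆ ψ` is a state. -/
def SchoenbergHolds (B : Type u)
    [NonUnitalRing B] [Module ℂ B] [IsScalarTower ℂ B B] [SMulCommClass ℂ B B]
    [StarRing B] [StarModule ℂ B] [DualSemigroup B] : Prop :=
  ∀ P : Independence.{u}, P.IsPositive → ∀ ψ : B →ₗ[ℂ] ℂ, IsCondPositive ψ →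
    ∀ φ : B →ₗ[ℂ] ℂ, P.IsConvExp ψ φ → IsState φ

/-! Near $0$ a convolution semigroup is governed by its generator alone, and a generator can be
moved along any homomorphism. On $\mathcal B$ the functionals $\exp_\star(\frac tn\psi)$ are states
by hypothesis, so their pullbacks $\chi_n=\exp_\star(\frac tn\psi)\circ\kappa$ are states on
$\mathcal C$. They satisfy $n\chi_n\to t\,\psi\circ\kappa$ pointwise, and the limit theorem
$\chi_n^{\star n}\to\exp_\star(t\,\psi\circ\kappa)$, with convolution powers taken in $\mathcal C$,
exhibits $\varphi_t$ as a pointwise limit of states. Since $\kappa$ enters only to first order, it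
need not respect the comultiplications.

The first prerequisite is the map $\sigma$: each value $(\varphi_1\odot\varphi_2)(x)$ must be a
polynomial in values of $\varphi_1$ and $\varphi_2$, although no regularity in the functionals is
assumed. Replacing $\varphi_1,\varphi_2$ by one functional on $\mathcal A\times\mathcal B$ turns a
word into a multilinear form natural in algebra homomorphisms (`NaturalForm`). On the free algebra,
rescaling letters shows that only short words matter (`NaturalForm.block_eq_zero`), and then that
each part of the form is a monomial (`exists_polynomial_of_homogeneous`). Naturality carries the
result to all algebras.

The second prerequisite is the limit theorem. The functionals $S(\varphi)$ separate the points of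
$S(\mathcal C)$, so the axioms of the independence make $S(\mathcal C)$ a coalgebra
(`Independence.IsSymbol.isCoalgebra`). Convolution by a functional becomes an operator preserving
finite-dimensional subspaces; there $\exp_\star$ is an ordinary matrix exponential and the limit
theorem is $X_n^n\to e^A$ when $n(X_n-1)\to A$ (`tendsto_pow_exp`). The same theorem shows that
$\exp_\star D(\psi)$ is multiplicative (`Independence.IsSymbol.lift_convExp`), which brings the
semigroup law from $S(\mathcal C)$ back to $\mathcal C$. -/

/-! ## The free non-unital algebra on finitely many letters -/

/-- The free non-unital complex algebra on `ι`, as the algebra of the free semigroup. -/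
abbrev WordAlgebra (ι : Type) : Type u := MonoidAlgebra ℂ (FreeSemigroup (ULift.{u} ι))

namespace WordAlgebra

variable {ι : Type}

/-- The basis element given by a word. -/
noncomputable def word (w : FreeSemigroup (ULift.{u} ι)) : WordAlgebra.{u} ι :=
  MonoidAlgebra.single w 1

/-- The generators. -/
noncomputable def letter (i : ι) : WordAlgebra.{u} ι := word (.of ⟨i⟩)

theorem word_mul (v w : FreeSemigroup (ULift.{u} ι)) : word (v * w) = word v * word w := by
  simp [word, MonoidAlgebra.single_mul_single]

theorem functional_ext {φ ψ : WordAlgebra.{u} ι →ₗ[ℂ] ℂ} (h : ∀ w, φ (word w) = ψ (word w)) :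
    φ = ψ := by
  refine MonoidAlgebra.lhom_ext' fun w => LinearMap.ext_ring ?_
  exact h w

/-- The linear functional with prescribed values on words. -/
noncomputable def functional (c : FreeSemigroup (ULift.{u} ι) → ℂ) : WordAlgebra.{u} ι →ₗ[ℂ] ℂ :=
  Finsupp.linearCombination ℂ c ∘ₗ (MonoidAlgebra.coeffLinearEquiv ℂ).toLinearMap

@[simp] theorem functional_word (c : FreeSemigroup (ULift.{u} ι) → ℂ) (w) :
    functional c (word w) = c w := by
  simp [functional, word]

variable {D : Type u} [NonUnitalRing D] [Module ℂ D] [IsScalarTower ℂ D D] [SMulCommClass ℂ D D]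

/-- The homomorphism with prescribed values on letters. -/
noncomputable def eval (z : ι → D) : WordAlgebra.{u} ι →ₙₐ[ℂ] D :=
  MonoidAlgebra.liftMagma ℂ (FreeSemigroup.lift fun i => z i.down)

@[simp] theorem eval_letter (z : ι → D) (i : ι) : eval z (letter i) = z i := by
  simp [eval, letter, word]

/-- Words are eigenvectors of the rescaling endomorphism. This grading by length drives both
homogeneity arguments below. -/
theorem eval_smul_letter_word (c : ℂ) (w : FreeSemigroup (ULift.{u} ι)) :
    eval (fun i => c • (letter i : WordAlgebra.{u} ι)) (word w) = c ^ w.length • word w := by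
  induction w using FreeSemigroup.recOnMul with
  | ih1 x =>
    have h := eval_letter (fun i => c • (letter i : WordAlgebra.{u} ι)) x.down
    simpa [letter, FreeSemigroup.length] using h
  | ih2 x y hx hy =>
    have hx : eval (fun i => c • (letter i : WordAlgebra.{u} ι)) (word (.of x)) = c • word (.of x) := by
      simpa [FreeSemigroup.length] using hx
    rw [word_mul, map_mul, hx, hy, FreeSemigroup.length_mul, pow_add, smul_mul_smul_comm]
    simp [FreeSemigroup.length]

theorem finite_length_le [Finite ι] (n : ℕ) :
    {w : FreeSemigroup (ULift.{u} ι) | w.length ≤ n}.Finite := by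
  refine Set.Finite.of_finite_image (f := fun w => w.head :: w.tail)
    ((List.finite_length_le (ULift.{u} ι) n).subset ?_) ?_
  · rintro _ ⟨w, hw, rfl⟩
    exact hw
  · intro v _ w _ h
    simp only [List.cons.injEq] at h
    exact FreeSemigroup.ext h.1 h.2

end WordAlgebra

/-! ## Natural multilinear forms -/

/-- A family of multilinear forms on complex algebras `D`, depending on a linear functional on `D`
and natural with respect to algebra homomorphisms. -/
structure NaturalForm (ι : Type) : Type (u + 1) where
  /-- The form. -/
  form : ∀ {D : Type u} [NonUnitalRing D] [Module ℂ D] [IsScalarTower ℂ D D] [SMulCommClass ℂ D D],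
    (D →ₗ[ℂ] ℂ) → MultilinearMap ℂ (fun _ : ι => D) ℂ
  /-- Naturality. -/
  form_comp : ∀ {D E : Type u}
    [NonUnitalRing D] [Module ℂ D] [IsScalarTower ℂ D D] [SMulCommClass ℂ D D]
    [NonUnitalRing E] [Module ℂ E] [IsScalarTower ℂ E E] [SMulCommClass ℂ E E]
    (j : D →ₙₐ[ℂ] E) (φ : E →ₗ[ℂ] ℂ) (z : ι → D),
    form (φ ∘ₗ (j : D →ₗ[ℂ] E)) z = form φ fun i => j (z i)

namespace NaturalForm

open WordAlgebra

variable {ι : Type} [DecidableEq ι] (F : NaturalForm.{u} ι)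

section Block

variable {D : Type u} [NonUnitalRing D] [Module ℂ D] [IsScalarTower ℂ D D] [SMulCommClass ℂ D D]
  {R : Type u} [NonUnitalRing R] [Module ℂ R] [IsScalarTower ℂ R R] [SMulCommClass ℂ R R]

/-- The value of the form on `D × R` when the arguments in `S` come from `D` and the others
from `R`. -/
def block (S : Finset ι) (x : ι → D) (r : ι → R) (ν : D →ₗ[ℂ] ℂ) (ρ : R →ₗ[ℂ] ℂ) : ℂ :=
  F.form (ν ∘ₗ LinearMap.fst ℂ D R + ρ ∘ₗ LinearMap.snd ℂ D R)
    (S.piecewise (fun i => (x i, 0)) fun i => (0, r i))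

theorem block_empty (x : ι → D) (r : ι → R) (ν : D →ₗ[ℂ] ℂ) (ρ : R →ₗ[ℂ] ℂ) :
    F.block ∅ x r ν ρ = F.form ρ r := by
  have h := F.form_comp (NonUnitalAlgHom.inr ℂ D R)
    (ν ∘ₗ LinearMap.fst ℂ D R + ρ ∘ₗ LinearMap.snd ℂ D R) r
  have e : (ν ∘ₗ LinearMap.fst ℂ D R + ρ ∘ₗ LinearMap.snd ℂ D R) ∘ₗ
      (NonUnitalAlgHom.inr ℂ D R : R →ₗ[ℂ] D × R) = ρ := by
    ext y; simp
  rw [e] at h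
  rw [h, block, Finset.piecewise_empty]
  rfl

/-- A sum of functionals is the pullback of $(\nu,\rho)$ along the diagonal $D\to D\times D$, and
multilinearity splits each diagonal argument into its two components. -/
theorem form_add [Fintype ι] (x : ι → D) (ν ρ : D →ₗ[ℂ] ℂ) :
    F.form (ν + ρ) x = ∑ S : Finset ι, F.block S x x ν ρ := by
  have h := F.form_comp (NonUnitalAlgHom.prod (NonUnitalAlgHom.id ℂ D) (NonUnitalAlgHom.id ℂ D))
    (ν ∘ₗ LinearMap.fst ℂ D D + ρ ∘ₗ LinearMap.snd ℂ D D) x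
  have e : (ν ∘ₗ LinearMap.fst ℂ D D + ρ ∘ₗ LinearMap.snd ℂ D D) ∘ₗ
      ((NonUnitalAlgHom.prod (NonUnitalAlgHom.id ℂ D) (NonUnitalAlgHom.id ℂ D) :
        D →ₙₐ[ℂ] D × D) : D →ₗ[ℂ] D × D) = ν + ρ := by
    ext y; simp
  rw [e] at h
  simp only [h, block, ← MultilinearMap.map_add_univ]
  congr 1
  ext i <;> simp

/-- Pull back along $(d,r)\mapsto(d,(d,r))$: $\nu$ and $\nu'$ live on separate copies of $D$, and
every argument in $S$ chooses a copy. -/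
theorem block_add (S : Finset ι) (x : ι → D) (r : ι → R) (ν ν' : D →ₗ[ℂ] ℂ) (ρ : R →ₗ[ℂ] ℂ) :
    F.block S x r (ν + ν') ρ = ∑ T ∈ S.powerset,
      F.block T x (S.piecewise (fun i => (x i, 0)) fun i => (0, r i)) ν
        (ν' ∘ₗ LinearMap.fst ℂ D R + ρ ∘ₗ LinearMap.snd ℂ D R) := by
  have h := F.form_comp (NonUnitalAlgHom.prod (NonUnitalAlgHom.fst ℂ D R)
      (NonUnitalAlgHom.id ℂ (D × R)))
    (ν ∘ₗ LinearMap.fst ℂ D (D × R) + (ν' ∘ₗ LinearMap.fst ℂ D R + ρ ∘ₗ LinearMap.snd ℂ D R) ∘ₗ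
      LinearMap.snd ℂ D (D × R)) (S.piecewise (fun i => (x i, 0)) fun i => (0, r i))
  have e : (ν ∘ₗ LinearMap.fst ℂ D (D × R) +
      (ν' ∘ₗ LinearMap.fst ℂ D R + ρ ∘ₗ LinearMap.snd ℂ D R) ∘ₗ
      LinearMap.snd ℂ D (D × R)) ∘ₗ ((NonUnitalAlgHom.prod (NonUnitalAlgHom.fst ℂ D R)
      (NonUnitalAlgHom.id ℂ (D × R)) : D × R →ₙₐ[ℂ] D × (D × R)) : D × R →ₗ[ℂ] D × (D × R)) =
      (ν + ν') ∘ₗ LinearMap.fst ℂ D R + ρ ∘ₗ LinearMap.snd ℂ D R := by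
    ext y <;> simp
  rw [e] at h
  simp only [block, h, ← MultilinearMap.map_piecewise_add]
  congr 1
  ext i <;> by_cases hi : i ∈ S <;> simp [hi]

/-- The copy of $D$ carrying $\nu'$ receives no argument, so naturality along
$(d,r)\mapsto(d,(0,r))$ removes it. -/
theorem block_self_add (S : Finset ι) (x : ι → D) (r : ι → R) (ν : D →ₗ[ℂ] ℂ) (ν' : D →ₗ[ℂ] ℂ)
    (ρ : R →ₗ[ℂ] ℂ) :
    F.block S x (S.piecewise (fun i => (x i, 0)) fun i => (0, r i)) ν
        (ν' ∘ₗ LinearMap.fst ℂ D R + ρ ∘ₗ LinearMap.snd ℂ D R) = F.block S x r ν ρ := by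
  have h := F.form_comp (NonUnitalAlgHom.prod (NonUnitalAlgHom.fst ℂ D R)
      ((NonUnitalAlgHom.inr ℂ D R).comp (NonUnitalAlgHom.snd ℂ D R)))
    (ν ∘ₗ LinearMap.fst ℂ D (D × R) + (ν' ∘ₗ LinearMap.fst ℂ D R + ρ ∘ₗ LinearMap.snd ℂ D R) ∘ₗ
      LinearMap.snd ℂ D (D × R)) (S.piecewise (fun i => (x i, 0)) fun i => (0, r i))
  have e : (ν ∘ₗ LinearMap.fst ℂ D (D × R) +
      (ν' ∘ₗ LinearMap.fst ℂ D R + ρ ∘ₗ LinearMap.snd ℂ D R) ∘ₗ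
      LinearMap.snd ℂ D (D × R)) ∘ₗ ((NonUnitalAlgHom.prod (NonUnitalAlgHom.fst ℂ D R)
      ((NonUnitalAlgHom.inr ℂ D R).comp (NonUnitalAlgHom.snd ℂ D R)) :
        D × R →ₙₐ[ℂ] D × (D × R)) : D × R →ₗ[ℂ] D × (D × R)) =
      ν ∘ₗ LinearMap.fst ℂ D R + ρ ∘ₗ LinearMap.snd ℂ D R := by
    ext y <;> simp
  rw [e] at h
  simp only [block, h]
  congr 1
  ext i <;> by_cases hi : i ∈ S <;> simp [hi]

theorem block_comp (S : Finset ι) (x : ι → D) (r : ι → R) (ν : D →ₗ[ℂ] ℂ) (ρ : R →ₗ[ℂ] ℂ)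
    (j : D →ₙₐ[ℂ] D) :
    F.block S x r (ν ∘ₗ (j : D →ₗ[ℂ] D)) ρ = F.block S (fun i => j (x i)) r ν ρ := by
  have h := F.form_comp (NonUnitalAlgHom.prod (j.comp (NonUnitalAlgHom.fst ℂ D R))
      (NonUnitalAlgHom.snd ℂ D R))
    (ν ∘ₗ LinearMap.fst ℂ D R + ρ ∘ₗ LinearMap.snd ℂ D R)
    (S.piecewise (fun i => (x i, 0)) fun i => (0, r i))
  have e : (ν ∘ₗ LinearMap.fst ℂ D R + ρ ∘ₗ LinearMap.snd ℂ D R) ∘ₗ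
      ((NonUnitalAlgHom.prod (j.comp (NonUnitalAlgHom.fst ℂ D R))
        (NonUnitalAlgHom.snd ℂ D R) : D × R →ₙₐ[ℂ] D × R) : D × R →ₗ[ℂ] D × R) =
      (ν ∘ₗ (j : D →ₗ[ℂ] D)) ∘ₗ LinearMap.fst ℂ D R + ρ ∘ₗ LinearMap.snd ℂ D R := by
    ext y <;> simp
  rw [e] at h
  simp only [block, h]
  congr 1
  ext i <;> by_cases hi : i ∈ S <;> simp [hi]

theorem block_smul (S : Finset ι) (x : ι → D) (r : ι → R) (ν : D →ₗ[ℂ] ℂ) (ρ : R →ₗ[ℂ] ℂ)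
    (c : ℂ) : F.block S (fun i => c • x i) r ν ρ = c ^ S.card * F.block S x r ν ρ := by
  have h := (F.form (ν ∘ₗ LinearMap.fst ℂ D R + ρ ∘ₗ LinearMap.snd ℂ D R)).map_piecewise_smul
    (fun _ => c) (S.piecewise (fun i => (x i, 0)) fun i => (0, r i)) S
  simp only [Finset.prod_const, smul_eq_mul] at h
  rw [block, block, ← h]
  congr 1
  ext i <;> by_cases hi : i ∈ S <;> simp [hi]

end Block

variable [Fintype ι]

/-- By induction on $S$ the block is additive in such $\nu$, while rescaling all letters multiplies
it by $2^{|S|}$. A functional concentrated on words longer than $|S|$ has the wrong degree for this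
and contributes nothing. The auxiliary algebra $R$ is generalized because the induction replaces it
by $D\times R$. -/
theorem block_eq_zero (S : Finset ι) (hS : S.Nonempty) : ∀ {R : Type u}
    [NonUnitalRing R] [Module ℂ R] [IsScalarTower ℂ R R] [SMulCommClass ℂ R R]
    (r : ι → R) (ρ : R →ₗ[ℂ] ℂ) (ν : WordAlgebra.{u} ι →ₗ[ℂ] ℂ),
    (∀ w, w.length ≤ Fintype.card ι → ν (word w) = 0) → F.block S letter r ν ρ = 0 := by
  induction S using Finset.strongInduction with
  | H S ih =>
    intro R _ _ _ _ r ρ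
    have hadd : ∀ ν ν' : WordAlgebra.{u} ι →ₗ[ℂ] ℂ,
        (∀ w, w.length ≤ Fintype.card ι → ν (word w) = 0) →
        F.block S letter r (ν + ν') ρ = F.block S letter r ν ρ + F.block S letter r ν' ρ := by
      intro ν ν' hν
      -- Proper nonempty $T$ vanish by induction; $T=S$ gives the term of $\nu$ and $T=\emptyset$
      -- that of $\nu'$.
      rw [block_add, Finset.sum_eq_add S ∅ hS.ne_empty]
      · rw [block_self_add, block_empty]
        rfl
      · rintro T hT ⟨h1, h2⟩
        rw [Finset.mem_powerset] at hT
        exact ih T (hT.ssubset_of_ne h1) (Finset.nonempty_iff_ne_empty.2 h2) _ _ ν hν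
      · intro h
        exact absurd (Finset.mem_powerset.2 (Finset.Subset.refl S)) h
      · intro h
        exact absurd (Finset.empty_mem_powerset S) h
    -- Additivity alone gives no complex homogeneity; scaling by powers of $2$ follows from repeated
    -- doubling and suffices.
    have hdouble : ∀ (k : ℕ) (ν : WordAlgebra.{u} ι →ₗ[ℂ] ℂ),
        (∀ w, w.length ≤ Fintype.card ι → ν (word w) = 0) →
        F.block S letter r ((2 ^ k : ℂ) • ν) ρ = 2 ^ k * F.block S letter r ν ρ := by
      intro k
      induction k with
      | zero => intro ν _; simp
      | succ k ihk =>
        intro ν hν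
        have e : (2 ^ (k + 1) : ℂ) • ν = (2 ^ k : ℂ) • ν + (2 ^ k : ℂ) • ν := by
          rw [← add_smul]; congr 1; ring
        rw [e, hadd _ _ (fun w hw => by simp [hν w hw]), ihk ν hν]
        ring
    intro ν hν
    -- Chosen to solve $\eta\circ s=\nu+2^{|S|}\eta$ for the rescaling $s$ by $2$. On short words
    -- the numerator is zero, so a vanishing denominator is harmless; on longer words the
    -- denominator is nonzero.
    let η : WordAlgebra.{u} ι →ₗ[ℂ] ℂ :=
      functional fun w => ν (word w) / (2 ^ w.length - 2 ^ S.card)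
    have hη : ∀ w, w.length ≤ Fintype.card ι → η (word w) = 0 := by
      intro w hw
      simp [η, hν w hw]
    let s : WordAlgebra.{u} ι →ₙₐ[ℂ] WordAlgebra.{u} ι := eval fun i => (2 : ℂ) • letter i
    have hs : η ∘ₗ (s : WordAlgebra.{u} ι →ₗ[ℂ] WordAlgebra.{u} ι) =
        ν + (2 ^ S.card : ℂ) • η := by
      refine functional_ext fun w => ?_
      have h1 : s (word w) = (2 : ℂ) ^ w.length • word w := eval_smul_letter_word 2 w
      simp only [LinearMap.comp_apply, LinearMap.coe_coe, LinearMap.add_apply,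
        LinearMap.smul_apply, smul_eq_mul, h1, map_smul, η, functional_word]
      by_cases hw : w.length ≤ Fintype.card ι
      · simp [hν w hw]
      · have hlt : S.card < w.length := lt_of_le_of_lt (Finset.card_le_univ S) (not_le.1 hw)
        have hne : (2 : ℂ) ^ w.length - 2 ^ S.card ≠ 0 := by
          rw [sub_ne_zero]
          exact_mod_cast (Nat.pow_lt_pow_right (by norm_num) hlt).ne'
        field_simp
        ring
    have h1 := F.block_comp S letter r η ρ s
    have h2 : (fun i => s (letter i)) = fun i => (2 : ℂ) • (letter i : WordAlgebra.{u} ι) :=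
      funext fun i => eval_letter _ i
    -- Both sides now contain $2^{|S|}$ times the block of $\eta$; cancelling it leaves the block of
    -- $\nu$ equal to zero.
    rw [hs, h2, block_smul, hadd _ _ hν, hdouble _ _ hη] at h1
    simpa using h1

/-- Only the values on words of length at most `card ι` matter. -/
theorem form_letter_congr (φ φ' : WordAlgebra.{u} ι →ₗ[ℂ] ℂ)
    (h : ∀ w, w.length ≤ Fintype.card ι → φ (word w) = φ' (word w)) :
    F.form φ letter = F.form φ' letter := by
  have e : φ = (φ - φ') + φ' := by simp
  rw [e, form_add, Finset.sum_eq_single ∅, block_empty]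
  · intro S _ hS
    exact F.block_eq_zero S (Finset.nonempty_iff_ne_empty.2 hS) _ _ _
      fun w hw => by simp [h w hw]
  · simp

end NaturalForm

/-- A function on `ℂ^K` that is homogeneous in each variable, with weights `d k ≥ 1` of the
variables and degrees `e k`, is a monomial. -/
theorem exists_polynomial_of_homogeneous {K : Type*} [Fintype K] [DecidableEq K]
    (H : (K → ℂ) → ℂ) (d e : K → ℕ) (hd : ∀ k, d k ≠ 0)
    (hH : ∀ l c : K → ℂ, H (fun k => l k ^ d k * c k) = (∏ k, l k ^ e k) * H c) :
    ∃ p : MvPolynomial K ℂ, ∀ c, H c = MvPolynomial.eval c p := by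
  by_cases h : ∀ k, d k ∣ e k
  · refine ⟨MvPolynomial.C (H 1) * ∏ k, MvPolynomial.X k ^ (e k / d k), fun c => ?_⟩
    -- With $l_k^{d_k}=c_k$, the point $c$ is a rescaling of $(1,\dots,1)$.
    choose l hl using fun k => IsAlgClosed.exists_pow_nat_eq (c k) (Nat.pos_of_ne_zero (hd k))
    have h1 := hH l 1
    simp only [Pi.one_apply, mul_one, hl] at h1
    rw [show H c = H fun k => c k from rfl, h1]
    simp only [map_mul, map_prod, map_pow, MvPolynomial.eval_C, MvPolynomial.eval_X]
    rw [mul_comm]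
    congr 1
    refine Finset.prod_congr rfl fun k _ => ?_
    rw [← hl k, ← pow_mul, Nat.mul_div_cancel' (h k)]
  · push Not at h
    obtain ⟨k, hk⟩ := h
    -- Rescaling the $k$-th variable by a primitive $d_k$-th root of unity fixes $c$ but multiplies
    -- $H(c)$ by $\zeta^{e_k}\ne1$, so $H=0$.
    have hζ := Complex.isPrimitiveRoot_exp (d k) (hd k)
    set ζ := Complex.exp (2 * Real.pi * Complex.I / d k)
    refine ⟨0, fun c => ?_⟩
    have h1 := hH (Function.update 1 k ζ) c
    have h2 : (fun j => Function.update (1 : K → ℂ) k ζ j ^ d j * c j) = c := by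
      funext j
      by_cases hj : j = k
      · subst hj; simp [hζ.pow_eq_one]
      · simp [hj]
    have h3 : ∏ j, Function.update (1 : K → ℂ) k ζ j ^ e j = ζ ^ e k := by
      rw [Finset.prod_eq_single k (fun j _ hj => by simp [hj]) (by simp)]
      simp
    rw [h2, h3] at h1
    have h4 : ζ ^ e k ≠ 1 := fun h => hk ((hζ.pow_eq_one_iff_dvd _).1 h)
    have h5 : (ζ ^ e k - 1) * H c = 0 := by linear_combination -h1
    simpa [sub_ne_zero.2 h4] using h5

/-! ### Polynomiality of natural forms -/

namespace NaturalForm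

open WordAlgebra

variable {ι : Type} [Fintype ι] (F : NaturalForm.{u} ι)

section Pi

variable {K : Type u} [Fintype K] [DecidableEq K]

/-- A family of homomorphisms on a product of algebras, acting on each factor. -/
def piMap {D : K → Type u} {E : K → Type u} [∀ k, NonUnitalRing (D k)] [∀ k, Module ℂ (D k)]
    [∀ k, NonUnitalRing (E k)] [∀ k, Module ℂ (E k)] (j : ∀ k, D k →ₙₐ[ℂ] E k) :
    (∀ k, D k) →ₙₐ[ℂ] (∀ k, E k) where
  toFun a k := j k (a k)
  map_smul' c a := by ext k; simp
  map_zero' := by ext k; simp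
  map_add' a b := by ext k; simp
  map_mul' a b := by ext k; simp

/-- The diagonal homomorphism. -/
def piDiag (K : Type u) (D : Type u) [NonUnitalRing D] [Module ℂ D] : D →ₙₐ[ℂ] (K → D) where
  toFun a _ := a
  map_smul' _ _ := rfl
  map_zero' := rfl
  map_add' _ _ := rfl
  map_mul' _ _ := rfl

/-- The functional `∑ k, c k • (δ_(w k) ∘ pr k)` on a power of the word algebra. -/
noncomputable def wordSum (w : K → FreeSemigroup (ULift.{u} ι)) (c : K → ℂ) :
    (K → WordAlgebra.{u} ι) →ₗ[ℂ] ℂ :=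
  open Classical in
  ∑ k, c k • (functional (Pi.single (w k) 1) ∘ₗ LinearMap.proj k)

/-- Rescaling the letters of the $m$-th factor by $l_m$ multiplies $c_m$ by $l_m^{|w_m|}$, and by
multilinearity multiplies the form by $l_m$ to the number of arguments in that factor. This is the
homogeneity that forces a monomial. -/
theorem exists_polynomial_form_single (w : K → FreeSemigroup (ULift.{u} ι)) (k : ι → K) :
    ∃ p : MvPolynomial K ℂ, ∀ c : K → ℂ,
      F.form (wordSum w c) (fun i => Pi.single (k i) (letter i)) = MvPolynomial.eval c p := by
  classical
  refine exists_polynomial_of_homogeneous _ (fun m => (w m).length)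
    (fun m => (Finset.univ.filter fun i => k i = m).card)
    (fun m => by simp [FreeSemigroup.length]) fun l c => ?_
  let s : K → (WordAlgebra.{u} ι →ₙₐ[ℂ] WordAlgebra.{u} ι) :=
    fun m => eval fun i => l m • letter i
  have h := F.form_comp (piMap s) (wordSum w c) fun i => Pi.single (k i) (letter i)
  have e : wordSum w c ∘ₗ (piMap s : (K → WordAlgebra.{u} ι) →ₗ[ℂ] (K → WordAlgebra.{u} ι)) =
      wordSum w fun m => l m ^ (w m).length * c m := by
    refine LinearMap.pi_ext' fun m => functional_ext fun v => ?_
    have h1 : s m (word v) = l m ^ v.length • word v := eval_smul_letter_word _ _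
    have h2 : piMap s (Pi.single m (word v)) = Pi.single m (l m ^ v.length • word v) := by
      funext n
      by_cases hn : n = m
      · subst hn; simpa [piMap] using h1
      · simp [piMap, hn]
    simp only [LinearMap.comp_apply, LinearMap.coe_single, LinearMap.coe_coe, h2]
    simp only [wordSum, LinearMap.sum_apply, LinearMap.smul_apply, LinearMap.comp_apply,
      LinearMap.proj_apply, smul_eq_mul]
    refine Finset.sum_congr rfl fun n _ => ?_
    by_cases hn : n = m
    · subst hn
      simp only [Pi.single_eq_same, map_smul, functional_word, smul_eq_mul]
      by_cases hv : v = w n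
      · subst hv; simp; ring
      · simp [hv]
    · simp [hn]
  have h3 : (fun i => piMap s (Pi.single (k i) (letter i))) =
      fun i => l (k i) • (Pi.single (k i) (letter i) : K → WordAlgebra.{u} ι) := by
    funext i n
    by_cases hn : n = k i
    · subst hn; simp [piMap, s]
    · simp [piMap, hn]
  rw [e, h3, MultilinearMap.map_smul_univ] at h
  rw [h, smul_eq_mul]
  congr 1
  rw [← Finset.prod_fiberwise (s := Finset.univ) (g := k)]
  refine Finset.prod_congr rfl fun m _ => ?_
  rw [Finset.prod_congr rfl (g := fun _ => l m) (fun i hi => by rw [(Finset.mem_filter.1 hi).2])]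
  simp

end Pi

/-- One factor is taken for each short word. The diagonal pulls `wordSum` back to a functional
agreeing with $\varphi$ on short words, and distributing the diagonal letters over the factors gives
a finite sum of monomials. -/
theorem exists_polynomial_form_letter :
    ∃ p : MvPolynomial (FreeSemigroup (ULift.{u} ι)) ℂ, ∀ φ : WordAlgebra.{u} ι →ₗ[ℂ] ℂ,
      F.form φ letter = MvPolynomial.eval (fun w => φ (word w)) p := by
  classical
  let K : Type u := {w : FreeSemigroup (ULift.{u} ι) // w.length ≤ Fintype.card ι}
  have : Fintype K := (finite_length_le.{u} (ι := ι) (Fintype.card ι)).fintype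
  let w : K → FreeSemigroup (ULift.{u} ι) := Subtype.val
  choose p hp using F.exists_polynomial_form_single w
  refine ⟨MvPolynomial.rename w (∑ k, p k), fun φ => ?_⟩
  let c : K → ℂ := fun m => φ (word (w m))
  have h := F.form_comp (piDiag K (WordAlgebra.{u} ι)) (wordSum w c) letter
  have h1 : F.form φ letter = F.form (wordSum w c ∘ₗ
      (piDiag K (WordAlgebra.{u} ι) : WordAlgebra.{u} ι →ₗ[ℂ] (K → WordAlgebra.{u} ι))) letter := by
    refine F.form_letter_congr _ _ fun v hv => ?_
    simp only [wordSum, LinearMap.comp_apply, LinearMap.sum_apply, LinearMap.smul_apply,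
      LinearMap.proj_apply, smul_eq_mul, LinearMap.coe_coe]
    rw [Finset.sum_eq_single (⟨v, hv⟩ : K)]
    · simp [piDiag, c, w]
    · intro m _ hm
      have : v ≠ w m := fun h => hm (Subtype.ext h.symm)
      simp [piDiag, this]
    · simp
  have h2 : (fun i : ι => piDiag K (WordAlgebra.{u} ι) (letter i)) =
      fun i => ∑ m : K, (Pi.single m (letter i) : K → WordAlgebra.{u} ι) := by
    funext i
    exact (Finset.univ_sum_single (piDiag K (WordAlgebra.{u} ι) (letter i))).symm
  rw [h1, h, h2, MultilinearMap.map_sum]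
  rw [MvPolynomial.eval_rename, map_sum]
  exact Finset.sum_congr rfl fun k _ => hp k c

/-- The value of a natural form at fixed arguments is a polynomial in finitely many values of the
functional. -/
theorem exists_polynomial_form {D : Type u} [NonUnitalRing D] [Module ℂ D] [IsScalarTower ℂ D D]
    [SMulCommClass ℂ D D] (z : ι → D) :
    ∃ p : MvPolynomial D ℂ, ∀ φ : D →ₗ[ℂ] ℂ, F.form φ z = MvPolynomial.eval φ p := by
  obtain ⟨p, hp⟩ := F.exists_polynomial_form_letter
  refine ⟨MvPolynomial.rename (fun w => eval z (word w)) p, fun φ => ?_⟩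
  have h := F.form_comp (eval z) φ letter
  rw [hp] at h
  simp only [eval_letter] at h
  rw [← h, MvPolynomial.eval_rename]
  rfl

end NaturalForm

/-! ## Separation of points -/

/-- In a basis of $V$, $S(V)$ is a polynomial algebra and the $S(\varphi)$ are its point
evaluations; a polynomial over an infinite field vanishing at every point is zero. -/
theorem SymmetricAlgebra.eq_zero_of_lift_eq_zero {V : Type u} [AddCommGroup V] [Module ℂ V]
    (x : SymmetricAlgebra ℂ V) (h : ∀ φ : V →ₗ[ℂ] ℂ, SymmetricAlgebra.lift φ x = 0) : x = 0 := by
  let b := Module.Basis.ofVectorSpace ℂ V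
  let e := SymmetricAlgebra.equivMvPolynomial b
  have key : ∀ c, MvPolynomial.eval c (e x) = 0 := by
    intro c
    have h1 : (MvPolynomial.aeval c).comp e.toAlgHom = SymmetricAlgebra.lift (b.constr ℂ c) := by
      refine SymmetricAlgebra.algHom_ext (b.ext fun i => ?_)
      simp [e, SymmetricAlgebra.equivMvPolynomial_ι_apply]
    have h2 := h (b.constr ℂ c)
    rw [← h1] at h2
    simpa [MvPolynomial.aeval_eq_eval] using h2
  have : e x = 0 := MvPolynomial.funext fun c => by rw [key, map_zero]
  simpa using this

/-- If `f` and `g` are families of functionals that separate points, then so do the functionals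
`f i ⊗ g j`. -/
theorem TensorProduct.eq_zero_of_map_eq_zero {V : Type*} {W : Type*} [AddCommGroup V] [Module ℂ V]
    [AddCommGroup W] [Module ℂ W] {I J : Type*} (f : I → V →ₗ[ℂ] ℂ) (g : J → W →ₗ[ℂ] ℂ)
    (hf : ∀ v, (∀ i, f i v = 0) → v = 0) (hg : ∀ w, (∀ j, g j w = 0) → w = 0)
    (z : V ⊗[ℂ] W)
    (hz : ∀ i j, LinearMap.mul' ℂ ℂ (TensorProduct.map (f i) (g j) z) = 0) : z = 0 := by
  -- The family $f$ kills every slice of $z$ along $g_j$. Then the coefficients of $z$ over a basis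
  -- of $V$ are killed by all $g_j$.
  have h1 : ∀ j, TensorProduct.rid ℂ V ((g j).lTensor V z) = 0 := by
    refine fun j => hf _ fun i => ?_
    have h : f i ∘ₗ (TensorProduct.rid ℂ V).toLinearMap ∘ₗ (g j).lTensor V =
        LinearMap.mul' ℂ ℂ ∘ₗ TensorProduct.map (f i) (g j) := by
      ext v w
      simp [mul_comm]
    exact (LinearMap.congr_fun h z).trans (hz i j)
  classical
  let b := Module.Basis.ofVectorSpace ℂ V
  have h2 : TensorProduct.equivFinsuppOfBasisLeft b z = 0 := by
    refine Finsupp.ext fun k => hg _ fun j => ?_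
    have h3 : ∀ z : V ⊗[ℂ] W, g j (TensorProduct.equivFinsuppOfBasisLeft b z k) =
        b.repr (TensorProduct.rid ℂ V ((g j).lTensor V z)) k := by
      intro z
      induction z using TensorProduct.induction_on with
      | zero => simp
      | tmul v w => simp [mul_comm]
      | add x y hx hy => simp [hx, hy]
    rw [h3, h1]
    simp
  simpa using h2

theorem productMap_eq_mul'_map {S T : Type*} [Semiring S] [Algebra ℂ S] [Semiring T] [Algebra ℂ T]
    (f : S →ₐ[ℂ] ℂ) (g : T →ₐ[ℂ] ℂ) (z : S ⊗[ℂ] T) :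
    Algebra.TensorProduct.productMap f g z =
      LinearMap.mul' ℂ ℂ (TensorProduct.map f.toLinearMap g.toLinearMap z) := by
  have h : (Algebra.TensorProduct.productMap f g).toLinearMap =
      LinearMap.mul' ℂ ℂ ∘ₗ TensorProduct.map f.toLinearMap g.toLinearMap := by
    ext a b
    simp
  exact LinearMap.congr_fun h z

theorem SymmetricAlgebra.eq_zero_of_productMap_eq_zero {A : Type u} {B : Type v}
    [AddCommGroup A] [Module ℂ A] [AddCommGroup B] [Module ℂ B]
    (s : SymmetricAlgebra ℂ A ⊗[ℂ] SymmetricAlgebra ℂ B)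
    (h : ∀ (φ₁ : A →ₗ[ℂ] ℂ) (φ₂ : B →ₗ[ℂ] ℂ), Algebra.TensorProduct.productMap
      (SymmetricAlgebra.lift φ₁) (SymmetricAlgebra.lift φ₂) s = 0) : s = 0 :=
  TensorProduct.eq_zero_of_map_eq_zero
    (fun φ : A →ₗ[ℂ] ℂ => (SymmetricAlgebra.lift φ).toLinearMap)
    (fun φ : B →ₗ[ℂ] ℂ => (SymmetricAlgebra.lift φ).toLinearMap)
    SymmetricAlgebra.eq_zero_of_lift_eq_zero SymmetricAlgebra.eq_zero_of_lift_eq_zero s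
    fun φ₁ φ₂ => (productMap_eq_mul'_map _ _ s).symm.trans (h φ₁ φ₂)

/-! ## Existence and uniqueness of the symbol map -/

/-- List products need a unit, so words are multiplied in the unitization and projected back. The
empty word then gives $0$. -/
theorem Unitization.snd_list_prod_map {X : Type*} {Y : Type*}
    [NonUnitalRing X] [Module ℂ X] [IsScalarTower ℂ X X] [SMulCommClass ℂ X X]
    [NonUnitalRing Y] [Module ℂ Y] [IsScalarTower ℂ Y Y] [SMulCommClass ℂ Y Y]
    (G : X →ₙₐ[ℂ] Y) (l : List X) :
    G (l.map (Unitization.inr (R := ℂ))).prod.snd =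
      ((l.map G).map (Unitization.inr (R := ℂ))).prod.snd := by
  let U : Unitization ℂ X →ₐ[ℂ] Unitization ℂ Y :=
    Unitization.lift ((Unitization.inrNonUnitalAlgHom ℂ Y).comp G)
  have h1 : ∀ x : X, U (x : Unitization ℂ X) = (G x : Unitization ℂ Y) := by
    intro x
    simp [U]
  have h2 : ∀ x : Unitization ℂ X, (U x).snd = G x.snd := by
    intro x
    induction x using Unitization.ind with
    | inl_add_inr r a =>
      rw [map_add, h1, Unitization.snd_add, Unitization.snd_add, ← Unitization.algebraMap_eq_inl,
        AlgHom.commutes]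
      simp [Unitization.algebraMap_eq_inl]
  rw [← h2, map_list_prod]
  simp only [List.map_map]
  congr 3
  exact congrArg (List.map · l) (funext h1)

namespace FreeProd

variable {A B : Type u} [NonUnitalRing A] [Module ℂ A] [NonUnitalRing B] [Module ℂ B]

/-- The letters of the free product. -/
def ofSum : A ⊕ B → FreeProd A B := Sum.elim inl inr

/-- The free product is spanned by words. -/
theorem word_induction {p : FreeProd A B → Prop} (zero : p 0)
    (word : ∀ l : List (A ⊕ B), p ((l.map ofSum).map (Unitization.inr (R := ℂ))).prod.snd)
    (add : ∀ x y, p x → p y → p (x + y)) (smul : ∀ (c : ℂ) x, p x → p (c • x))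
    (x : FreeProd A B) : p x := by
  let s : Set (Unitization ℂ (FreeProd A B)) := Set.range fun a : A ⊕ B => (ofSum a : _)
  have h1 : ∀ x : FreeProd A B, (x : Unitization ℂ (FreeProd A B)) ∈ Algebra.adjoin ℂ s := by
    intro x
    induction x using FreeProd.induction with
    | h_inl a => exact Algebra.subset_adjoin ⟨.inl a, rfl⟩
    | h_inr b => exact Algebra.subset_adjoin ⟨.inr b, rfl⟩
    | h_add x y hx hy => rw [Unitization.inr_add]; exact add_mem hx hy
    | h_mul x y hx hy => rw [Unitization.inr_mul]; exact mul_mem hx hy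
    | h_smul c x hx => rw [Unitization.inr_smul]; exact Subalgebra.smul_mem _ hx c
  have h2 : ∀ y ∈ Submodule.span ℂ (Submonoid.closure s : Set (Unitization ℂ (FreeProd A B))),
      p y.snd := by
    intro y hy
    induction hy using Submodule.span_induction with
    | mem y hy =>
      obtain ⟨l, hl, rfl⟩ := Submonoid.exists_list_of_mem_closure hy
      have hl' : l ∈ Set.range (List.map fun a : A ⊕ B =>
          (ofSum a : Unitization ℂ (FreeProd A B))) := by
        rw [Set.range_list_map]
        exact hl
      obtain ⟨l', rfl⟩ := hl'
      have h := word l'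
      rwa [List.map_map] at h
    | zero => exact zero
    | add x y _ _ hx hy => exact add _ _ hx hy
    | smul c x _ hx => exact smul _ _ hx
  have h3 := h1 x
  rw [← Subalgebra.mem_toSubmodule, Algebra.adjoin_eq_span] at h3
  exact h2 _ h3

end FreeProd

/-- The embeddings of `D` into `D ⊔ D`. -/
def FreeProd.embed (D : Type u) [NonUnitalRing D] [Module ℂ D] (b : Bool) :
    D →ₙₐ[ℂ] FreeProd D D :=
  bif b then FreeProd.inl else FreeProd.inr

namespace Independence

variable (P : Independence.{u})

/-- The natural form `(φ ⊙ φ)(w(z))` given by a word `w`, where `ε` tells which letters belong to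
the first factor. -/
noncomputable def wordForm {n : ℕ} (ε : Fin n → Bool) : NaturalForm.{u} (Fin n) where
  form {D} _ _ _ _ φ :=
    (P.prod φ φ ∘ₗ Unitization.sndHom ℂ ℂ (FreeProd D D)).compMultilinearMap
      ((MultilinearMap.mkPiAlgebraFin ℂ n (Unitization ℂ (FreeProd D D))).compLinearMap fun i =>
        Unitization.inrHom ℂ ℂ (FreeProd D D) ∘ₗ
          (FreeProd.embed D (ε i) : D →ₗ[ℂ] FreeProd D D))
  form_comp {D E} _ _ _ _ _ _ _ _ j φ z := by
    simp only [P.prod_comp, LinearMap.compMultilinearMap_apply, MultilinearMap.compLinearMap_apply,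
      MultilinearMap.mkPiAlgebraFin_apply, LinearMap.comp_apply, Unitization.inrHom_apply,
      Unitization.sndHom_apply, LinearMap.coe_coe]
    congr 1
    have h := Unitization.snd_list_prod_map (FreeProd.map j j)
      (List.ofFn fun i => FreeProd.embed D (ε i) (z i))
    simp only [List.map_ofFn] at h
    refine h.trans ?_
    congr 3
    refine congrArg List.ofFn (funext fun i => ?_)
    simp only [Function.comp_apply]
    congr 1
    cases ε i <;> rfl

variable {A B : Type u}
  [NonUnitalRing A] [Module ℂ A] [IsScalarTower ℂ A A] [SMulCommClass ℂ A A]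
  [NonUnitalRing B] [Module ℂ B] [IsScalarTower ℂ B B] [SMulCommClass ℂ B B]

/-- Let $\Phi=\varphi_1\circ\mathrm{pr}_1+\varphi_2\circ\mathrm{pr}_2$ on $A\times B$. Then (A3)
makes $\varphi_1\odot\varphi_2$ the pullback of $\Phi\odot\Phi$ along the two inclusions, so its
value on a word is a natural form in $\Phi$, hence a polynomial in values of $\Phi$. -/
theorem exists_symbol_apply (x : FreeProd A B) :
    ∃ s : SymmetricAlgebra ℂ A ⊗[ℂ] SymmetricAlgebra ℂ B,
      ∀ (φ₁ : A →ₗ[ℂ] ℂ) (φ₂ : B →ₗ[ℂ] ℂ), P.prod φ₁ φ₂ x =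
        Algebra.TensorProduct.productMap (SymmetricAlgebra.lift φ₁) (SymmetricAlgebra.lift φ₂) s := by
  induction x using FreeProd.word_induction with
  | zero => exact ⟨0, fun _ _ => by simp⟩
  | add x y hx hy =>
    obtain ⟨s, hs⟩ := hx
    obtain ⟨t, ht⟩ := hy
    exact ⟨s + t, fun φ₁ φ₂ => by rw [map_add, map_add, hs, ht]⟩
  | smul c x hx =>
    obtain ⟨s, hs⟩ := hx
    exact ⟨c • s, fun φ₁ φ₂ => by rw [map_smul, map_smul, hs]⟩
  | word l =>
    let F := P.wordForm fun i => (l.get i).isLeft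
    let z : Fin l.length → A × B := fun i => Sum.elim (fun a => (a, 0)) (fun b => (0, b)) (l.get i)
    obtain ⟨p, hp⟩ := F.exists_polynomial_form z
    -- The variable standing for $\Phi(d)=\varphi_1(d_1)+\varphi_2(d_2)$ is replaced by
    -- $d_1\otimes1+1\otimes d_2$.
    refine ⟨MvPolynomial.aeval (fun d : A × B => SymmetricAlgebra.ι ℂ A d.1 ⊗ₜ[ℂ] 1 +
      1 ⊗ₜ[ℂ] SymmetricAlgebra.ι ℂ B d.2) p, fun φ₁ φ₂ => ?_⟩
    let Φ : A × B →ₗ[ℂ] ℂ := φ₁ ∘ₗ LinearMap.fst ℂ A B + φ₂ ∘ₗ LinearMap.snd ℂ A B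
    have h1 : Algebra.TensorProduct.productMap (SymmetricAlgebra.lift φ₁)
        (SymmetricAlgebra.lift φ₂) (MvPolynomial.aeval (fun d : A × B =>
          SymmetricAlgebra.ι ℂ A d.1 ⊗ₜ[ℂ] 1 + 1 ⊗ₜ[ℂ] SymmetricAlgebra.ι ℂ B d.2) p) =
        MvPolynomial.eval Φ p := by
      rw [← AlgHom.comp_apply, MvPolynomial.comp_aeval, ← MvPolynomial.aeval_eq_eval]
      congr 2
      funext d
      simp [Φ]
    rw [h1, ← hp Φ]
    have hl : Φ ∘ₗ (NonUnitalAlgHom.inl ℂ A B : A →ₗ[ℂ] A × B) = φ₁ := by ext a; simp [Φ]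
    have hr : Φ ∘ₗ (NonUnitalAlgHom.inr ℂ A B : B →ₗ[ℂ] A × B) = φ₂ := by ext b; simp [Φ]
    have h2 := P.prod_comp Φ Φ (NonUnitalAlgHom.inl ℂ A B) (NonUnitalAlgHom.inr ℂ A B)
    rw [hl, hr] at h2
    rw [h2, LinearMap.comp_apply, LinearMap.coe_coe, Unitization.snd_list_prod_map]
    simp only [F, wordForm, LinearMap.compMultilinearMap_apply, MultilinearMap.compLinearMap_apply,
      MultilinearMap.mkPiAlgebraFin_apply, LinearMap.comp_apply, Unitization.inrHom_apply,
      Unitization.sndHom_apply, LinearMap.coe_coe]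
    congr 3
    conv_lhs => rw [← List.ofFn_get l]
    simp only [List.map_ofFn]
    congr 1
    refine congrArg List.ofFn (funext fun i => ?_)
    simp only [Function.comp_apply, z]
    congr 1
    cases l.get i <;> rfl

variable (A B) in
theorem exists_isSymbol :
    ∃ σ : FreeProd A B →ₗ[ℂ] SymmetricAlgebra ℂ A ⊗[ℂ] SymmetricAlgebra ℂ B, P.IsSymbol σ := by
  choose σ hσ using fun x => P.exists_symbol_apply (A := A) (B := B) x
  refine ⟨{ toFun := σ, map_add' := fun x y => ?_, map_smul' := fun c x => ?_ },
    fun φ₁ φ₂ x => hσ x φ₁ φ₂⟩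
  · refine sub_eq_zero.1 (SymmetricAlgebra.eq_zero_of_productMap_eq_zero _ fun φ₁ φ₂ => ?_)
    rw [map_sub, map_add, ← hσ, ← hσ, ← hσ, map_add, sub_self]
  · refine sub_eq_zero.1 (SymmetricAlgebra.eq_zero_of_productMap_eq_zero _ fun φ₁ φ₂ => ?_)
    rw [map_sub, RingHom.id_apply, map_smul, ← hσ, ← hσ, map_smul, sub_self]

theorem IsSymbol.unique {P : Independence.{u}}
    {σ τ : FreeProd A B →ₗ[ℂ] SymmetricAlgebra ℂ A ⊗[ℂ] SymmetricAlgebra ℂ B}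
    (hσ : P.IsSymbol σ) (hτ : P.IsSymbol τ) : σ = τ := by
  ext x
  refine sub_eq_zero.1 (SymmetricAlgebra.eq_zero_of_productMap_eq_zero _ fun φ₁ φ₂ => ?_)
  rw [map_sub, ← hσ, ← hτ, sub_self]

end Independence

/-! ## Exponentials of endomorphisms of finite-dimensional spaces -/

section BanachAlgebra

variable {𝔸 : Type*} [NormedRing 𝔸]

/-- Telescoping. The factor $\|1\|$ is kept because the norm of the unit need not be $1$: matrices
of size zero are allowed. -/
theorem norm_pow_sub_pow_le {X Y : 𝔸} {c : ℝ} (hX : ‖X - 1‖ ≤ c) (hY : ‖Y - 1‖ ≤ c) (k : ℕ) :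
    ‖X ^ k - Y ^ k‖ ≤ k * ‖X - Y‖ * ((1 + c) ^ k * ‖(1 : 𝔸)‖) := by
  have hc : 0 ≤ c := (norm_nonneg _).trans hX
  have key : ∀ Z : 𝔸, ‖Z - 1‖ ≤ c → ∀ v, ‖Z * v‖ ≤ (1 + c) * ‖v‖ := by
    intro Z hZ v
    calc ‖Z * v‖ = ‖v + (Z - 1) * v‖ := by congr 1; noncomm_ring
      _ ≤ ‖v‖ + ‖Z - 1‖ * ‖v‖ := (norm_add_le _ _).trans (by gcongr; exact norm_mul_le _ _)
      _ ≤ (1 + c) * ‖v‖ := by rw [add_mul, one_mul]; gcongr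
  have hpow : ∀ k : ℕ, ‖Y ^ k‖ ≤ (1 + c) ^ k * ‖(1 : 𝔸)‖ := by
    intro k
    induction k with
    | zero => simp
    | succ k ih =>
      rw [pow_succ']
      refine (key Y hY _).trans ?_
      rw [pow_succ', mul_assoc]
      gcongr
  induction k with
  | zero => simp
  | succ k ih =>
    have e : X ^ (k + 1) - Y ^ (k + 1) = X * (X ^ k - Y ^ k) + (X - Y) * Y ^ k := by
      rw [pow_succ', pow_succ']; noncomm_ring
    have h1 : (1 + c) ^ k ≤ (1 + c) ^ (k + 1) := pow_le_pow_right₀ (by linarith) (Nat.le_succ k)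
    rw [e]
    calc _ ≤ (1 + c) * ‖X ^ k - Y ^ k‖ + ‖X - Y‖ * ‖Y ^ k‖ :=
          (norm_add_le _ _).trans (add_le_add (key X hX _) (norm_mul_le _ _))
      _ ≤ (1 + c) * (k * ‖X - Y‖ * ((1 + c) ^ k * ‖(1 : 𝔸)‖)) +
            ‖X - Y‖ * ((1 + c) ^ (k + 1) * ‖(1 : 𝔸)‖) := by
          have := hpow k
          gcongr
          exact this.trans (by gcongr)
      _ = _ := by push_cast; ring

variable [NormedAlgebra ℂ 𝔸] [CompleteSpace 𝔸]

theorem tendsto_nsmul_exp_sub_one (A : 𝔸) :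
    Tendsto (fun n : ℕ => (n : ℂ) • (NormedSpace.exp ((n : ℂ)⁻¹ • A) - 1)) atTop (𝓝 A) := by
  have h := (hasDerivAt_exp_smul_const A (0 : ℂ)).tendsto_slope_zero
  simp only [zero_add, zero_smul, NormedSpace.exp_zero, one_mul] at h
  have h2 : Tendsto (fun n : ℕ => (n : ℂ)⁻¹) atTop (𝓝[≠] 0) := by
    refine tendsto_nhdsWithin_iff.2 ⟨tendsto_inv_atTop_nhds_zero_nat, ?_⟩
    filter_upwards [eventually_gt_atTop 0] with n hn
    simp [hn.ne']
  have h3 := h.comp h2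
  simpa [Function.comp_def] using h3

/-- Compare $X_n$ with $Y_n=e^{A/n}$, for which $Y_n^n=e^A$ when $n>0$. The difference of the $n$-th
powers is at most $n\|X_n-Y_n\|$ times the bounded quantity $(1+c/n)^n\|1\|$ with $c=\|A\|+1$. -/
theorem tendsto_pow_exp {X : ℕ → 𝔸} {A : 𝔸}
    (h : Tendsto (fun n : ℕ => (n : ℂ) • (X n - 1)) atTop (𝓝 A)) :
    Tendsto (fun n => X n ^ n) atTop (𝓝 (NormedSpace.exp A)) := by
  let Y : ℕ → 𝔸 := fun n => NormedSpace.exp ((n : ℂ)⁻¹ • A)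
  have hY : Tendsto (fun n : ℕ => (n : ℂ) • (Y n - 1)) atTop (𝓝 A) := tendsto_nsmul_exp_sub_one A
  have hd : Tendsto (fun n : ℕ => ‖(n : ℂ) • (X n - Y n)‖) atTop (𝓝 0) := by
    have h1 := (h.sub hY).norm
    simp only [sub_self, norm_zero] at h1
    refine h1.congr fun n => ?_
    rw [← smul_sub]
    congr 2
    abel
  have hb : ∀ Z : ℕ → 𝔸, Tendsto (fun n : ℕ => (n : ℂ) • (Z n - 1)) atTop (𝓝 A) →
      ∀ᶠ n : ℕ in atTop, ‖Z n - 1‖ ≤ (‖A‖ + 1) / n := by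
    intro Z hZ
    filter_upwards [hZ.norm.eventually (gt_mem_nhds (lt_add_one ‖A‖)), eventually_gt_atTop 0]
      with n hn hn0
    have hn0' : (0 : ℝ) < n := by exact_mod_cast hn0
    rw [norm_smul] at hn
    rw [le_div_iff₀ hn0', mul_comm]
    simpa using hn.le
  have hXY : Tendsto (fun n => X n ^ n - Y n ^ n) atTop (𝓝 0) := by
    refine squeeze_zero_norm' (a := fun n : ℕ => ‖(n : ℂ) • (X n - Y n)‖ *
      (Real.exp (‖A‖ + 1) * ‖(1 : 𝔸)‖)) ?_ (by simpa using hd.mul_const _)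
    filter_upwards [hb X h, hb Y hY, eventually_gt_atTop 0] with n h1 h2 hn0
    refine (norm_pow_sub_pow_le h1 h2 n).trans ?_
    have hn0' : (n : ℝ) ≠ 0 := by exact_mod_cast hn0.ne'
    have h3 : (1 + (‖A‖ + 1) / n) ^ n ≤ Real.exp (‖A‖ + 1) := by
      have h4 : (1 + (‖A‖ + 1) / n) ^ n ≤ Real.exp ((‖A‖ + 1) / n) ^ n := by
        gcongr
        rw [add_comm]
        exact Real.add_one_le_exp _
      rwa [← Real.exp_nat_mul, mul_div_cancel₀ _ hn0'] at h4
    rw [norm_smul, Complex.norm_natCast]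
    gcongr
  have hYn : ∀ᶠ n in atTop, Y n ^ n = NormedSpace.exp A := by
    filter_upwards [eventually_gt_atTop 0] with n hn
    have hn' : (n : ℂ) ≠ 0 := by exact_mod_cast hn.ne'
    let _ : NormedAlgebra ℚ 𝔸 := NormedAlgebra.restrictScalars ℚ ℂ 𝔸
    rw [← NormedSpace.exp_nsmul, ← Nat.cast_smul_eq_nsmul ℂ, smul_smul, mul_inv_cancel₀ hn',
      one_smul]
  have h5 := hXY.add (tendsto_const_nhds.congr' (hYn.mono fun _ h => h.symm))
  simpa using h5

end BanachAlgebra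

section FiniteDimensional

variable {V : Type*} [AddCommGroup V] [Module ℂ V] [Module.Finite ℂ V]

attribute [local instance] Matrix.linftyOpNormedRing Matrix.linftyOpNormedAlgebra

/-- The exponential of an endomorphism of a finite-dimensional complex vector space. -/
noncomputable def expEnd (T : Module.End ℂ V) : Module.End ℂ V :=
  (LinearMap.toMatrixAlgEquiv (Module.finBasis ℂ V)).symm
    (NormedSpace.exp (LinearMap.toMatrixAlgEquiv (Module.finBasis ℂ V) T))

/-- Matrix coefficients are continuous. -/
theorem continuous_toMatrixAlgEquiv_symm_apply (f : V →ₗ[ℂ] ℂ) (y : V) :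
    Continuous fun M : Matrix _ _ ℂ =>
      f ((LinearMap.toMatrixAlgEquiv (Module.finBasis ℂ V)).symm M y) :=
  (f ∘ₗ LinearMap.applyₗ y ∘ₗ
    (LinearMap.toMatrixAlgEquiv (Module.finBasis ℂ V)).symm.toLinearMap).continuous_of_finiteDimensional

theorem hasSum_expEnd (T : Module.End ℂ V) (f : V →ₗ[ℂ] ℂ) (y : V) :
    HasSum (fun n : ℕ => (n.factorial : ℂ)⁻¹ * f ((T ^ n) y)) (f (expEnd T y)) := by
  let θ := LinearMap.toMatrixAlgEquiv (Module.finBasis ℂ V)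
  have h := NormedSpace.exp_series_hasSum_exp' (𝕂 := ℂ) (θ T)
  have h2 := h.map (f ∘ₗ LinearMap.applyₗ y ∘ₗ θ.symm.toLinearMap)
    (continuous_toMatrixAlgEquiv_symm_apply f y)
  refine h2.congr_fun fun n => ?_
  simp only [Function.comp_apply, LinearMap.comp_apply, LinearMap.applyₗ_apply_apply,
    AlgEquiv.toLinearMap_apply, ← map_pow, map_smul, smul_eq_mul,
    AlgEquiv.symm_apply_apply]

theorem expEnd_zero : expEnd (0 : Module.End ℂ V) = 1 := by
  simp [expEnd]

theorem expEnd_add_smul (s t : ℂ) (T : Module.End ℂ V) :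
    expEnd ((s + t) • T) = expEnd (s • T) * expEnd (t • T) := by
  rw [expEnd, expEnd, expEnd, ← map_mul, ← Matrix.exp_add_of_commute, ← map_add, add_smul]
  rw [map_smul, map_smul]
  exact ((Commute.refl _).smul_left s).smul_right t

theorem tendsto_expEnd_smul (T : Module.End ℂ V) (f : V →ₗ[ℂ] ℂ) (y : V) :
    Tendsto (fun t : ℂ => f (expEnd (t • T) y)) (𝓝 0) (𝓝 (f y)) := by
  let θ := LinearMap.toMatrixAlgEquiv (Module.finBasis ℂ V)
  have h1 : Tendsto (fun t : ℂ => NormedSpace.exp (t • θ T)) (𝓝 0) (𝓝 1) := by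
    have h := (hasDerivAt_exp_smul_const (θ T) (0 : ℂ)).continuousAt.tendsto
    simp only [zero_smul, NormedSpace.exp_zero] at h
    exact h
  have h2 := ((continuous_toMatrixAlgEquiv_symm_apply f y).tendsto 1).comp h1
  rw [map_one, Module.End.one_apply] at h2
  refine h2.congr fun t => ?_
  rw [expEnd, map_smul]
  rfl

theorem tendsto_nsmul_expEnd_sub (T : Module.End ℂ V) (f : V →ₗ[ℂ] ℂ) (y : V) :
    Tendsto (fun n : ℕ => (n : ℂ) * (f (expEnd ((n : ℂ)⁻¹ • T) y) - f y)) atTop (𝓝 (f (T y))) := by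
  let θ := LinearMap.toMatrixAlgEquiv (Module.finBasis ℂ V)
  have h1 := tendsto_nsmul_exp_sub_one (θ T)
  have h2 := ((continuous_toMatrixAlgEquiv_symm_apply f y).tendsto _).comp h1
  rw [AlgEquiv.symm_apply_apply] at h2
  refine h2.congr fun n => ?_
  rw [Function.comp_apply, map_smul, map_sub, map_one, LinearMap.smul_apply, map_smul,
    LinearMap.sub_apply, map_sub, Module.End.one_apply, smul_eq_mul, expEnd, map_smul]
  rfl

theorem tendsto_pow_expEnd {T : ℕ → Module.End ℂ V} {A : Module.End ℂ V}
    (h : ∀ (f : V →ₗ[ℂ] ℂ) (y : V),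
      Tendsto (fun n : ℕ => (n : ℂ) * (f (T n y) - f y)) atTop (𝓝 (f (A y))))
    (f : V →ₗ[ℂ] ℂ) (y : V) :
    Tendsto (fun n => f ((T n ^ n) y)) atTop (𝓝 (f (expEnd A y))) := by
  let b := Module.finBasis ℂ V
  let θ := LinearMap.toMatrixAlgEquiv b
  have h1 : Tendsto (fun n : ℕ => (n : ℂ) • (θ (T n) - 1)) atTop (𝓝 (θ A)) := by
    refine tendsto_pi_nhds.2 fun i => tendsto_pi_nhds.2 fun j => ?_
    have h2 := h (b.coord i) (b j)
    simpa [θ, LinearMap.toMatrixAlgEquiv_apply, Matrix.one_apply, Finsupp.single_apply,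
      eq_comm] using h2
  have h2 := ((continuous_toMatrixAlgEquiv_symm_apply f y).tendsto _).comp (tendsto_pow_exp h1)
  refine h2.congr fun n => ?_
  rw [Function.comp_apply, ← map_pow, AlgEquiv.symm_apply_apply]

end FiniteDimensional

/-! ## Convolution exponentials on coalgebras -/

section Coalgebra

variable {V : Type u} [AddCommGroup V] [Module ℂ V]

/-- `Δ` is coassociative with counit `δ`. -/
structure IsCoalgebra (Δ : V →ₗ[ℂ] V ⊗[ℂ] V) (δ : V →ₗ[ℂ] ℂ) : Prop where
  coassoc : ∀ x, TensorProduct.assoc ℂ V V V (Δ.rTensor V (Δ x)) = Δ.lTensor V (Δ x)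
  counit_left : ∀ x, TensorProduct.lid ℂ V (δ.rTensor V (Δ x)) = x
  counit_right : ∀ x, TensorProduct.rid ℂ V (δ.lTensor V (Δ x)) = x

/-- The operator `(id ⊗ f) ∘ Δ`. -/
noncomputable def convOp (Δ : V →ₗ[ℂ] V ⊗[ℂ] V) (f : V →ₗ[ℂ] ℂ) : Module.End ℂ V :=
  (TensorProduct.rid ℂ V).toLinearMap ∘ₗ f.lTensor V ∘ₗ Δ

variable {Δ : V →ₗ[ℂ] V ⊗[ℂ] V} {δ : V →ₗ[ℂ] ℂ}

theorem apply_convOp (g f : V →ₗ[ℂ] ℂ) (x : V) :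
    g (convOp Δ f x) = LinearMap.mul' ℂ ℂ (TensorProduct.map g f (Δ x)) := by
  have h : g ∘ₗ (TensorProduct.rid ℂ V).toLinearMap ∘ₗ f.lTensor V =
      LinearMap.mul' ℂ ℂ ∘ₗ TensorProduct.map g f := by
    ext v w
    simp [mul_comm]
  exact LinearMap.congr_fun h (Δ x)

theorem tensorConv_apply (g f : V →ₗ[ℂ] ℂ) (x : V) :
    tensorConv Δ g f x = g (convOp Δ f x) :=
  (apply_convOp g f x).symm

theorem convOp_smul (c : ℂ) (f : V →ₗ[ℂ] ℂ) : convOp Δ (c • f) = c • convOp Δ f := by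
  simp [convOp, LinearMap.lTensor_smul, LinearMap.comp_smul, LinearMap.smul_comp]

theorem convOp_add (f g : V →ₗ[ℂ] ℂ) : convOp Δ (f + g) = convOp Δ f + convOp Δ g := by
  simp [convOp, LinearMap.lTensor_add, LinearMap.comp_add, LinearMap.add_comp]

/-- Slices of a tensor span a finite-dimensional space. -/
theorem exists_finiteDimensional_slice (z : V ⊗[ℂ] V) :
    ∃ N : Submodule ℂ V, FiniteDimensional ℂ N ∧
      ∀ g : V →ₗ[ℂ] ℂ, TensorProduct.rid ℂ V (g.lTensor V z) ∈ N := by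
  induction z using TensorProduct.induction_on with
  | zero => exact ⟨⊥, inferInstance, fun g => by simp⟩
  | tmul v w =>
    refine ⟨Submodule.span ℂ {v}, inferInstance, fun g => ?_⟩
    simpa using Submodule.smul_mem _ _ (Submodule.mem_span_singleton_self v)
  | add x y hx hy =>
    obtain ⟨M, hM, hM'⟩ := hx
    obtain ⟨N, hN, hN'⟩ := hy
    refine ⟨M ⊔ N, inferInstance, fun g => ?_⟩
    rw [map_add, map_add]
    exact Submodule.add_mem_sup (hM' g) (hN' g)

/-- The space of all `(id ⊗ g)(Δ x)`. -/
noncomputable def convOrbit (Δ : V →ₗ[ℂ] V ⊗[ℂ] V) (x : V) : Submodule ℂ V where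
  carrier := Set.range fun g : V →ₗ[ℂ] ℂ => convOp Δ g x
  zero_mem' := ⟨0, by simp [convOp]⟩
  add_mem' := by
    rintro _ _ ⟨f, rfl⟩ ⟨g, rfl⟩
    exact ⟨f + g, by simp [convOp_add]⟩
  smul_mem' := by
    rintro c _ ⟨f, rfl⟩
    exact ⟨c • f, by simp [convOp_smul]⟩

instance (x : V) : FiniteDimensional ℂ (convOrbit Δ x) := by
  obtain ⟨N, hN, hN'⟩ := exists_finiteDimensional_slice (Δ x)
  refine Submodule.finiteDimensional_of_le (S₂ := N) ?_
  rintro _ ⟨g, rfl⟩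
  exact hN' g

namespace IsCoalgebra

/-- By coassociativity, convolution of functionals becomes composition of operators; with
`counit_convOp`, which recovers $f$ from its operator, this turns convolution series into operator
series. -/
theorem convOp_mul (h : IsCoalgebra Δ δ) (g f : V →ₗ[ℂ] ℂ) :
    convOp Δ g * convOp Δ f = convOp Δ (tensorConv Δ g f) := by
  have e1 : (TensorProduct.rid ℂ V).toLinearMap ∘ₗ
      (LinearMap.mul' ℂ ℂ ∘ₗ TensorProduct.map g f).lTensor V ∘ₗ
      (TensorProduct.assoc ℂ V V V).toLinearMap =
      (TensorProduct.rid ℂ V).toLinearMap ∘ₗ f.lTensor V ∘ₗ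
        ((TensorProduct.rid ℂ V).toLinearMap ∘ₗ g.lTensor V).rTensor V := by
    ext a b w
    simp [smul_smul, mul_comm]
  have e2 : (TensorProduct.rid ℂ V).toLinearMap ∘ₗ f.lTensor V ∘ₗ (convOp Δ g).rTensor V =
      convOp Δ g ∘ₗ (TensorProduct.rid ℂ V).toLinearMap ∘ₗ f.lTensor V := by
    ext v w
    simp
  ext x
  have e3 := LinearMap.congr_fun e1 (Δ.rTensor V (Δ x))
  have e4 := LinearMap.congr_fun e2 (Δ x)
  simp only [LinearMap.comp_apply, LinearEquiv.coe_coe, h.coassoc] at e3 e4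
  rw [Module.End.mul_apply]
  refine e4.symm.trans ?_
  have e5 : (convOp Δ g).rTensor V (Δ x) =
      ((TensorProduct.rid ℂ V).toLinearMap ∘ₗ g.lTensor V).rTensor V (Δ.rTensor V (Δ x)) := by
    rw [← LinearMap.rTensor_comp_apply]
    rfl
  rw [e5, ← e3]
  rw [← LinearMap.lTensor_comp_apply]
  rfl

theorem convOp_counit (h : IsCoalgebra Δ δ) : convOp Δ δ = 1 :=
  LinearMap.ext h.counit_right

theorem counit_convOp (h : IsCoalgebra Δ δ) (f : V →ₗ[ℂ] ℂ) (x : V) : δ (convOp Δ f x) = f x := by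
  rw [apply_convOp]
  conv_rhs => rw [← h.counit_left x]
  have e : LinearMap.mul' ℂ ℂ ∘ₗ TensorProduct.map δ f =
      f ∘ₗ (TensorProduct.lid ℂ V).toLinearMap ∘ₗ δ.rTensor V := by
    ext v w
    simp
  exact LinearMap.congr_fun e (Δ x)

theorem tensorConvPow_apply (f : V →ₗ[ℂ] ℂ) (n : ℕ) (x : V) :
    tensorConvPow Δ δ f n x = δ ((convOp Δ f ^ n) x) := by
  induction n generalizing x with
  | zero => rfl
  | succ n ih => rw [tensorConvPow, tensorConv_apply, ih, pow_succ, Module.End.mul_apply]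

theorem convOp_tensorConvPow (h : IsCoalgebra Δ δ) (f : V →ₗ[ℂ] ℂ) (n : ℕ) :
    convOp Δ (tensorConvPow Δ δ f n) = convOp Δ f ^ n := by
  induction n with
  | zero => exact h.convOp_counit
  | succ n ih => rw [tensorConvPow, ← h.convOp_mul, ih, pow_succ]

theorem mem_convOrbit (h : IsCoalgebra Δ δ) (x : V) : x ∈ convOrbit Δ x :=
  ⟨δ, by simp [h.convOp_counit]⟩

theorem convOp_mem_convOrbit (h : IsCoalgebra Δ δ) (f : V →ₗ[ℂ] ℂ) (x : V) :
    ∀ y ∈ convOrbit Δ x, convOp Δ f y ∈ convOrbit Δ x := by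
  rintro _ ⟨g, rfl⟩
  exact ⟨tensorConv Δ f g, by simp [← h.convOp_mul]⟩

/-- The restriction of `(id ⊗ f) ∘ Δ` to the finite-dimensional invariant space of `x`. -/
noncomputable def orbitOp (h : IsCoalgebra Δ δ) (f : V →ₗ[ℂ] ℂ) (x : V) :
    Module.End ℂ (convOrbit Δ x) :=
  (convOp Δ f).restrict (h.convOp_mem_convOrbit f x)

theorem coe_orbitOp (h : IsCoalgebra Δ δ) (f : V →ₗ[ℂ] ℂ) (x : V) (y : convOrbit Δ x) :
    (h.orbitOp f x y : V) = convOp Δ f y := rfl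

theorem coe_orbitOp_pow (h : IsCoalgebra Δ δ) (f : V →ₗ[ℂ] ℂ) (x : V) (n : ℕ)
    (y : convOrbit Δ x) : ((h.orbitOp f x ^ n) y : V) = (convOp Δ f ^ n) y := by
  induction n generalizing y with
  | zero => rfl
  | succ n ih => rw [pow_succ, pow_succ, Module.End.mul_apply, Module.End.mul_apply, ih, coe_orbitOp]

theorem orbitOp_smul (h : IsCoalgebra Δ δ) (c : ℂ) (f : V →ₗ[ℂ] ℂ) (x : V) :
    h.orbitOp (c • f) x = c • h.orbitOp f x := by
  ext y
  simp [coe_orbitOp, convOp_smul]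

/-- The exponential series of `(id ⊗ f) ∘ Δ` converges weakly. -/
theorem hasSum_apply_convOp_pow (h : IsCoalgebra Δ δ) (l f : V →ₗ[ℂ] ℂ) (x : V)
    (y : convOrbit Δ x) :
    HasSum (fun n : ℕ => (n.factorial : ℂ)⁻¹ * l ((convOp Δ f ^ n) y))
      (l (expEnd (h.orbitOp f x) y)) := by
  have h1 := hasSum_expEnd (h.orbitOp f x) (l ∘ₗ (convOrbit Δ x).subtype) y
  simpa only [LinearMap.comp_apply, Submodule.subtype_apply, coe_orbitOp_pow] using h1

theorem hasTensorConvExpAt (h : IsCoalgebra Δ δ) (f : V →ₗ[ℂ] ℂ) (x : V) (y : convOrbit Δ x) :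
    HasTensorConvExpAt Δ δ f y (δ (expEnd (h.orbitOp f x) y)) := by
  have h1 := h.hasSum_apply_convOp_pow δ f x y
  simpa only [HasTensorConvExpAt, tensorConvPow_apply] using h1

/-- The convolution exponential of a functional on a coalgebra. -/
noncomputable def convExp (h : IsCoalgebra Δ δ) (f : V →ₗ[ℂ] ℂ) : V →ₗ[ℂ] ℂ where
  toFun x := δ (expEnd (h.orbitOp f x) ⟨x, h.mem_convOrbit x⟩)
  -- The operators for $x$, $y$ and $x+y$ act on different orbits, so linearity is read off from the
  -- common series.
  map_add' x y := by
    have h1 := (h.hasTensorConvExpAt f x ⟨x, h.mem_convOrbit x⟩).add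
      (h.hasTensorConvExpAt f y ⟨y, h.mem_convOrbit y⟩)
    refine (h.hasTensorConvExpAt f (x + y) ⟨x + y, h.mem_convOrbit _⟩).unique ?_
    simpa only [map_add, mul_add] using h1
  map_smul' c x := by
    have h1 := (h.hasTensorConvExpAt f x ⟨x, h.mem_convOrbit x⟩).mul_left c
    refine (h.hasTensorConvExpAt f (c • x) ⟨c • x, h.mem_convOrbit _⟩).unique ?_
    simpa only [map_smul, smul_eq_mul, RingHom.id_apply, mul_left_comm] using h1

theorem convExp_apply (h : IsCoalgebra Δ δ) (f : V →ₗ[ℂ] ℂ) (x : V) :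
    h.convExp f x = δ (expEnd (h.orbitOp f x) ⟨x, h.mem_convOrbit x⟩) := rfl

theorem hasTensorConvExpAt_convExp (h : IsCoalgebra Δ δ) (f : V →ₗ[ℂ] ℂ) (x : V) :
    HasTensorConvExpAt Δ δ f x (h.convExp f x) :=
  h.hasTensorConvExpAt f x ⟨x, h.mem_convOrbit x⟩

theorem convExp_apply_coe (h : IsCoalgebra Δ δ) (f : V →ₗ[ℂ] ℂ) (x : V) (y : convOrbit Δ x) :
    h.convExp f y = δ (expEnd (h.orbitOp f x) y) :=
  (h.hasTensorConvExpAt_convExp f y).unique (h.hasTensorConvExpAt f x y)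

/-- Convolving with $l$ commutes with the series, because $\Delta x$ is a finite sum of elementary
tensors. -/
theorem tensorConv_convExp (h : IsCoalgebra Δ δ) (l f : V →ₗ[ℂ] ℂ) (x : V) :
    tensorConv Δ l (h.convExp f) x = l (expEnd (h.orbitOp f x) ⟨x, h.mem_convOrbit x⟩) := by
  have h1 : ∀ z : V ⊗[ℂ] V, HasSum (fun n : ℕ => (n.factorial : ℂ)⁻¹ *
      LinearMap.mul' ℂ ℂ (TensorProduct.map l (tensorConvPow Δ δ f n) z))
      (LinearMap.mul' ℂ ℂ (TensorProduct.map l (h.convExp f) z)) := by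
    intro z
    induction z using TensorProduct.induction_on with
    | zero => simp
    | tmul v w =>
      have h2 := (h.hasTensorConvExpAt_convExp f w).mul_left (l v)
      simpa only [TensorProduct.map_tmul, LinearMap.mul'_apply, mul_left_comm] using h2
    | add x y hx hy => simpa only [map_add, mul_add] using hx.add hy
  refine (h1 (Δ x)).unique ?_
  have h3 := h.hasSum_apply_convOp_pow l f x ⟨x, h.mem_convOrbit x⟩
  simpa only [← apply_convOp, h.convOp_tensorConvPow] using h3

theorem convExp_add_smul (h : IsCoalgebra Δ δ) (s t : ℂ) (f : V →ₗ[ℂ] ℂ) :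
    h.convExp ((s + t) • f) = tensorConv Δ (h.convExp (s • f)) (h.convExp (t • f)) := by
  ext x
  rw [h.tensorConv_convExp, h.convExp_apply_coe, h.convExp_apply, h.orbitOp_smul, h.orbitOp_smul,
    h.orbitOp_smul, expEnd_add_smul, Module.End.mul_apply]

theorem convExp_zero (h : IsCoalgebra Δ δ) : h.convExp 0 = δ := by
  ext x
  have e : h.orbitOp 0 x = 0 := by
    have := h.orbitOp_smul 0 0 x
    simpa using this
  rw [h.convExp_apply, e, expEnd_zero, Module.End.one_apply]

theorem tendsto_convExp_smul (h : IsCoalgebra Δ δ) (f : V →ₗ[ℂ] ℂ) (x : V) :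
    Tendsto (fun t : ℂ => h.convExp (t • f) x) (𝓝 0) (𝓝 (δ x)) := by
  have h1 := tendsto_expEnd_smul (h.orbitOp f x) (δ ∘ₗ (convOrbit Δ x).subtype)
    ⟨x, h.mem_convOrbit x⟩
  simpa only [h.convExp_apply, h.orbitOp_smul, LinearMap.comp_apply, Submodule.subtype_apply]
    using h1

theorem tendsto_nsmul_convExp_sub (h : IsCoalgebra Δ δ) (f : V →ₗ[ℂ] ℂ) (x : V) :
    Tendsto (fun n : ℕ => (n : ℂ) * (h.convExp ((n : ℂ)⁻¹ • f) x - δ x)) atTop (𝓝 (f x)) := by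
  have h1 := tendsto_nsmul_expEnd_sub (h.orbitOp f x) (δ ∘ₗ (convOrbit Δ x).subtype)
    ⟨x, h.mem_convOrbit x⟩
  simpa only [h.convExp_apply, h.orbitOp_smul, LinearMap.comp_apply, Submodule.subtype_apply,
    coe_orbitOp, h.counit_convOp] using h1

/-- A limit theorem: `n (g n - δ) → f` implies `(g n)^⋆n → exp_⋆ f`. -/
theorem tendsto_tensorConvPow (h : IsCoalgebra Δ δ) {g : ℕ → V →ₗ[ℂ] ℂ} {f : V →ₗ[ℂ] ℂ}
    (hg : ∀ x, Tendsto (fun n : ℕ => (n : ℂ) * (g n x - δ x)) atTop (𝓝 (f x))) (x : V) :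
    Tendsto (fun n => tensorConvPow Δ δ (g n) n x) atTop (𝓝 (h.convExp f x)) := by
  have h1 : ∀ (l : V →ₗ[ℂ] ℂ) (z : V ⊗[ℂ] V), Tendsto (fun n : ℕ => (n : ℂ) *
      (LinearMap.mul' ℂ ℂ (TensorProduct.map l (g n) z) -
        LinearMap.mul' ℂ ℂ (TensorProduct.map l δ z))) atTop
      (𝓝 (LinearMap.mul' ℂ ℂ (TensorProduct.map l f z))) := by
    intro l z
    induction z using TensorProduct.induction_on with
    | zero => simp
    | tmul v w =>
      refine ((hg w).const_mul (l v)).congr fun n => ?_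
      simp only [TensorProduct.map_tmul, LinearMap.mul'_apply]
      ring
    | add x y hx hy =>
      simp only [map_add]
      refine (hx.add hy).congr fun n => ?_
      ring
  have h2 := tendsto_pow_expEnd (T := fun n => h.orbitOp (g n) x) (A := h.orbitOp f x) ?_
    (δ ∘ₗ (convOrbit Δ x).subtype) ⟨x, h.mem_convOrbit x⟩
  · simpa only [LinearMap.comp_apply, Submodule.subtype_apply, coe_orbitOp_pow,
      ← tensorConvPow_apply, ← h.convExp_apply] using h2
  · intro l y
    -- Functionals on the orbit extend to $V$, where they can be paired with $\Delta y$.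
    obtain ⟨l, rfl⟩ := l.exists_extend
    have h3 := h1 l (Δ y)
    simpa only [← apply_convOp, h.convOp_counit, Module.End.one_apply, LinearMap.comp_apply,
      Submodule.subtype_apply, coe_orbitOp] using h3

end IsCoalgebra

end Coalgebra

/-! ## The functional `D(ψ)` -/

section SymDeriv

variable {V : Type u} [AddCommGroup V] [Module ℂ V] (ψ : V →ₗ[ℂ] ℂ)

theorem symDeriv_apply (x : SymmetricAlgebra ℂ V) :
    symDeriv ψ x = deriv (fun t : ℝ => SymmetricAlgebra.lift ((t : ℂ) • ψ) x) 0 := rfl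

theorem symDeriv_ι (v : V) : symDeriv ψ (SymmetricAlgebra.ι ℂ V v) = ψ v := by
  have h : HasDerivAt (fun t : ℝ => (t : ℂ) * ψ v) (1 * ψ v) 0 :=
    (Complex.ofRealCLM.hasDerivAt (x := (0 : ℝ))).mul_const (ψ v)
  rw [symDeriv_apply]
  simpa using h.deriv

theorem symDeriv_algebraMap (r : ℂ) : symDeriv ψ (algebraMap ℂ _ r) = 0 := by
  simp [symDeriv_apply]

theorem symDeriv_mul (x y : SymmetricAlgebra ℂ V) :
    symDeriv ψ (x * y) = symDeriv ψ x * SymmetricAlgebra.lift (0 : V →ₗ[ℂ] ℂ) y +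
      SymmetricAlgebra.lift (0 : V →ₗ[ℂ] ℂ) x * symDeriv ψ y := by
  have h := deriv_fun_mul (differentiable_symLift ψ x 0) (differentiable_symLift ψ y 0)
  simpa [symDeriv_apply] using h

theorem symDeriv_ofReal_smul (c : ℝ) : symDeriv ((c : ℂ) • ψ) = (c : ℂ) • symDeriv ψ := by
  ext x
  have h := deriv_comp_mul_left c (fun t : ℝ => SymmetricAlgebra.lift ((t : ℂ) • ψ) x) 0
  simp only [LinearMap.smul_apply, symDeriv_apply, smul_smul]
  simpa [mul_comm] using h

/-- If `n χ n → ψ` pointwise, then `n (S(χ n) - S(0)) → D(ψ)` pointwise. -/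
theorem tendsto_nsmul_lift_sub {χ : ℕ → V →ₗ[ℂ] ℂ}
    (hχ : ∀ v, Tendsto (fun n : ℕ => (n : ℂ) * χ n v) atTop (𝓝 (ψ v)))
    (x : SymmetricAlgebra ℂ V) :
    Tendsto (fun n : ℕ => (n : ℂ) * (SymmetricAlgebra.lift (χ n) x -
      SymmetricAlgebra.lift (0 : V →ₗ[ℂ] ℂ) x)) atTop (𝓝 (symDeriv ψ x)) := by
  induction x using SymmetricAlgebra.induction with
  | algebraMap r => simp [symDeriv_algebraMap]
  | ι v => simpa [symDeriv_ι] using hχ v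
  | add x y hx hy =>
    rw [map_add (symDeriv ψ)]
    refine (hx.add hy).congr fun n => ?_
    simp only [map_add]
    ring
  | mul x y hx hy =>
    have h0 : Tendsto (fun n : ℕ => (n : ℂ)⁻¹) atTop (𝓝 0) := tendsto_inv_atTop_nhds_zero_nat
    have hy' : Tendsto (fun n : ℕ => SymmetricAlgebra.lift (χ n) y) atTop
        (𝓝 (SymmetricAlgebra.lift (0 : V →ₗ[ℂ] ℂ) y)) := by
      have h1 := (h0.mul hy).add_const (SymmetricAlgebra.lift (0 : V →ₗ[ℂ] ℂ) y)
      simp only [zero_mul, zero_add] at h1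
      refine h1.congr' ?_
      filter_upwards [eventually_gt_atTop 0] with n hn
      have hn' : (n : ℂ) ≠ 0 := by exact_mod_cast hn.ne'
      field_simp
      ring
    rw [symDeriv_mul]
    refine ((hx.mul hy').add (hy.const_mul _)).congr fun n => ?_
    simp only [map_mul]
    ring

end SymDeriv

/-! ## The coalgebra structure on the symmetric tensor algebra of a dual semigroup -/

namespace Independence

variable {P : Independence.{u}} {B : Type u}
  [NonUnitalRing B] [Module ℂ B] [IsScalarTower ℂ B B] [SMulCommClass ℂ B B]
  [StarRing B] [StarModule ℂ B] [DualSemigroup B]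

variable (P) in
theorem conv_apply (φ₁ φ₂ : B →ₗ[ℂ] ℂ) (b : B) :
    P.conv φ₁ φ₂ b = P.prod φ₁ φ₂ (DualSemigroup.comul b) := rfl

variable (P) in
theorem conv_assoc (φ₁ φ₂ φ₃ : B →ₗ[ℂ] ℂ) :
    P.conv (P.conv φ₁ φ₂) φ₃ = P.conv φ₁ (P.conv φ₂ φ₃) := by
  ext b
  have h1 := P.prod_comp (P.prod φ₁ φ₂) φ₃ (DualSemigroup.comul (B := B)).toNonUnitalAlgHom
    (NonUnitalAlgHom.id ℂ B)
  have h2 := P.prod_comp φ₁ (P.prod φ₂ φ₃) (NonUnitalAlgHom.id ℂ B)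
    (DualSemigroup.comul (B := B)).toNonUnitalAlgHom
  have e : ∀ φ : B →ₗ[ℂ] ℂ, φ ∘ₗ (NonUnitalAlgHom.id ℂ B : B →ₗ[ℂ] B) = φ := fun _ => rfl
  rw [e] at h1 h2
  have h3 : P.conv (P.conv φ₁ φ₂) φ₃ b = P.prod (P.prod φ₁ φ₂) φ₃ (FreeProd.map
      (DualSemigroup.comul (B := B)).toNonUnitalAlgHom (NonUnitalAlgHom.id ℂ B)
      (DualSemigroup.comul b)) := LinearMap.congr_fun h1 (DualSemigroup.comul b)
  have h4 : P.conv φ₁ (P.conv φ₂ φ₃) b = P.prod φ₁ (P.prod φ₂ φ₃) (FreeProd.map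
      (NonUnitalAlgHom.id ℂ B) (DualSemigroup.comul (B := B)).toNonUnitalAlgHom
      (DualSemigroup.comul b)) := LinearMap.congr_fun h2 (DualSemigroup.comul b)
  rw [h3, h4, P.prod_assoc, DualSemigroup.coassoc]

variable (P) in
-- Writing $0=\varphi\circ0$, (A3) gives
-- $0\odot\varphi=(\varphi\odot\varphi)\circ(0\amalg\mathrm{id})$. Since
-- $0\amalg\mathrm{id}=i_2\circ(0\sqcup\mathrm{id})$, (A1) and the counit law finish.
theorem zero_conv (φ : B →ₗ[ℂ] ℂ) : P.conv 0 φ = φ := by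
  ext b
  have h1 := P.prod_comp φ φ (0 : B →ₙₐ[ℂ] B) (NonUnitalAlgHom.id ℂ B)
  have e1 : φ ∘ₗ ((0 : B →ₙₐ[ℂ] B) : B →ₗ[ℂ] B) = 0 := by ext; simp
  have e2 : φ ∘ₗ (NonUnitalAlgHom.id ℂ B : B →ₗ[ℂ] B) = φ := rfl
  have e3 : FreeProd.map (0 : B →ₙₐ[ℂ] B) (NonUnitalAlgHom.id ℂ B) =
      FreeProd.inr.comp (FreeProd.lift 0 (NonUnitalAlgHom.id ℂ B)) :=
    FreeProd.hom_ext (fun _ => by simp [FreeProd.map]) (fun _ => by simp [FreeProd.map])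
  rw [e1, e2, e3] at h1
  rw [conv_apply, h1, LinearMap.comp_apply, LinearMap.coe_coe, NonUnitalAlgHom.comp_apply,
    P.prod_inr, DualSemigroup.counit_left]

variable (P) in
theorem conv_zero (φ : B →ₗ[ℂ] ℂ) : P.conv φ 0 = φ := by
  ext b
  have h1 := P.prod_comp φ φ (NonUnitalAlgHom.id ℂ B) (0 : B →ₙₐ[ℂ] B)
  have e1 : φ ∘ₗ ((0 : B →ₙₐ[ℂ] B) : B →ₗ[ℂ] B) = 0 := by ext; simp
  have e2 : φ ∘ₗ (NonUnitalAlgHom.id ℂ B : B →ₗ[ℂ] B) = φ := rfl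
  have e3 : FreeProd.map (NonUnitalAlgHom.id ℂ B) (0 : B →ₙₐ[ℂ] B) =
      FreeProd.inl.comp (FreeProd.lift (NonUnitalAlgHom.id ℂ B) 0) :=
    FreeProd.hom_ext (fun _ => by simp [FreeProd.map]) (fun _ => by simp [FreeProd.map])
  rw [e1, e2, e3] at h1
  rw [conv_apply, h1, LinearMap.comp_apply, LinearMap.coe_coe, NonUnitalAlgHom.comp_apply,
    P.prod_inl, DualSemigroup.counit_right]

variable (P) in
/-- Convolution powers of a functional on a dual semigroup. -/
def convPow (φ : B →ₗ[ℂ] ℂ) : ℕ → (B →ₗ[ℂ] ℂ)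
  | 0 => 0
  | n + 1 => P.conv (convPow φ n) φ

namespace IsSymbol

variable {σ : FreeProd B B →ₗ[ℂ] SymmetricAlgebra ℂ B ⊗[ℂ] SymmetricAlgebra ℂ B}

theorem tensorConv_lift (hσ : P.IsSymbol σ) (φ₁ φ₂ : B →ₗ[ℂ] ℂ) :
    tensorConv (symComul σ).toLinearMap (SymmetricAlgebra.lift φ₁).toLinearMap
      (SymmetricAlgebra.lift φ₂).toLinearMap =
      (SymmetricAlgebra.lift (P.conv φ₁ φ₂)).toLinearMap := by
  have h : (Algebra.TensorProduct.productMap (SymmetricAlgebra.lift φ₁)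
      (SymmetricAlgebra.lift φ₂)).comp (symComul σ) = SymmetricAlgebra.lift (P.conv φ₁ φ₂) := by
    refine SymmetricAlgebra.algHom_ext (LinearMap.ext fun b => ?_)
    change Algebra.TensorProduct.productMap _ _ (symComul σ (SymmetricAlgebra.ι ℂ B b)) =
      SymmetricAlgebra.lift _ (SymmetricAlgebra.ι ℂ B b)
    rw [symComul, SymmetricAlgebra.lift_ι_apply, SymmetricAlgebra.lift_ι_apply]
    exact (hσ φ₁ φ₂ _).symm
  ext x
  exact (productMap_eq_mul'_map _ _ _).symm.trans (DFunLike.congr_fun h x)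

theorem tensorConvPow_lift (hσ : P.IsSymbol σ) (φ : B →ₗ[ℂ] ℂ) (n : ℕ) :
    tensorConvPow (symComul σ).toLinearMap (SymmetricAlgebra.lift (0 : B →ₗ[ℂ] ℂ)).toLinearMap
      (SymmetricAlgebra.lift φ).toLinearMap n =
      (SymmetricAlgebra.lift (P.convPow φ n)).toLinearMap := by
  induction n with
  | zero => rfl
  | succ n ih => rw [tensorConvPow, ih, hσ.tensorConv_lift, convPow]

/-- Tested against the separating functionals $S(\varphi)$ and their tensor products, the coalgebra
axioms become associativity of $\star$ and neutrality of $0$. -/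
theorem isCoalgebra (hσ : P.IsSymbol σ) : IsCoalgebra (symComul σ).toLinearMap
    (SymmetricAlgebra.lift (0 : B →ₗ[ℂ] ℂ)).toLinearMap := by
  set Δ := (symComul σ).toLinearMap
  let S : (B →ₗ[ℂ] ℂ) → (SymmetricAlgebra ℂ B →ₗ[ℂ] ℂ) :=
    fun φ => (SymmetricAlgebra.lift φ).toLinearMap
  have hS : ∀ φ₁ φ₂ x, LinearMap.mul' ℂ ℂ (TensorProduct.map (S φ₁) (S φ₂) (Δ x)) =
      S (P.conv φ₁ φ₂) x := fun φ₁ φ₂ x => LinearMap.congr_fun (hσ.tensorConv_lift φ₁ φ₂) x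
  refine ⟨fun x => ?_, fun x => ?_, fun x => ?_⟩
  · refine sub_eq_zero.1 (TensorProduct.eq_zero_of_map_eq_zero S
      (fun p : (B →ₗ[ℂ] ℂ) × (B →ₗ[ℂ] ℂ) =>
        LinearMap.mul' ℂ ℂ ∘ₗ TensorProduct.map (S p.1) (S p.2))
      SymmetricAlgebra.eq_zero_of_lift_eq_zero (fun z hz =>
        SymmetricAlgebra.eq_zero_of_productMap_eq_zero z fun φ₁ φ₂ =>
          (productMap_eq_mul'_map _ _ z).trans (hz (φ₁, φ₂))) _ ?_)
    rintro φ₁ ⟨φ₂, φ₃⟩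
    rw [map_sub, map_sub, sub_eq_zero]
    have e1 : LinearMap.mul' ℂ ℂ ∘ₗ TensorProduct.map (S φ₁) (LinearMap.mul' ℂ ℂ ∘ₗ
          TensorProduct.map (S φ₂) (S φ₃)) ∘ₗ (TensorProduct.assoc ℂ _ _ _).toLinearMap =
        LinearMap.mul' ℂ ℂ ∘ₗ TensorProduct.map (LinearMap.mul' ℂ ℂ ∘ₗ
          TensorProduct.map (S φ₁) (S φ₂)) (S φ₃) := by
      ext
      simp [mul_assoc]
    have e2 := LinearMap.congr_fun e1 (Δ.rTensor _ (Δ x))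
    simp only [LinearMap.comp_apply, LinearEquiv.coe_coe] at e2
    rw [e2, ← LinearMap.comp_apply (TensorProduct.map _ _) (Δ.rTensor _),
      ← LinearMap.comp_apply (TensorProduct.map _ _) (Δ.lTensor _), LinearMap.map_comp_rTensor,
      LinearMap.map_comp_lTensor]
    have e3 : ∀ φ₁ φ₂, (LinearMap.mul' ℂ ℂ ∘ₗ TensorProduct.map (S φ₁) (S φ₂)) ∘ₗ Δ =
        S (P.conv φ₁ φ₂) := fun φ₁ φ₂ => LinearMap.ext (hS φ₁ φ₂)
    rw [e3, e3, hS, hS, P.conv_assoc]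
  · refine sub_eq_zero.1 (SymmetricAlgebra.eq_zero_of_lift_eq_zero _ fun φ => ?_)
    rw [map_sub, sub_eq_zero]
    have e1 : S φ ∘ₗ (TensorProduct.lid ℂ _).toLinearMap ∘ₗ (S 0).rTensor _ =
        LinearMap.mul' ℂ ℂ ∘ₗ TensorProduct.map (S 0) (S φ) := by
      ext
      simp
    have e2 := LinearMap.congr_fun e1 (Δ x)
    exact e2.trans ((hS 0 φ x).trans (by rw [P.zero_conv]; rfl))
  · refine sub_eq_zero.1 (SymmetricAlgebra.eq_zero_of_lift_eq_zero _ fun φ => ?_)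
    rw [map_sub, sub_eq_zero]
    have e1 : S φ ∘ₗ (TensorProduct.rid ℂ _).toLinearMap ∘ₗ (S 0).lTensor _ =
        LinearMap.mul' ℂ ℂ ∘ₗ TensorProduct.map (S φ) (S 0) := by
      ext
      simp [mul_comm]
    have e2 := LinearMap.congr_fun e1 (Δ x)
    exact e2.trans ((hS φ 0 x).trans (by rw [P.conv_zero]; rfl))

/-- If `n χ n → ψ` pointwise, then the convolution powers `(χ n)^⋆n` converge to the convolution
exponential of `D(ψ)`. -/
theorem tendsto_lift_convPow (hσ : P.IsSymbol σ) (ψ : B →ₗ[ℂ] ℂ) {χ : ℕ → B →ₗ[ℂ] ℂ}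
    (hχ : ∀ v, Tendsto (fun n : ℕ => (n : ℂ) * χ n v) atTop (𝓝 (ψ v)))
    (x : SymmetricAlgebra ℂ B) :
    Tendsto (fun n : ℕ => SymmetricAlgebra.lift (P.convPow (χ n) n) x) atTop
      (𝓝 (hσ.isCoalgebra.convExp (symDeriv ψ) x)) := by
  have h := hσ.isCoalgebra.tendsto_tensorConvPow
    (g := fun n => (SymmetricAlgebra.lift (χ n)).toLinearMap) (tendsto_nsmul_lift_sub ψ hχ) x
  simpa only [hσ.tensorConvPow_lift, AlgHom.toLinearMap_apply] using h

/-- The convolution exponential `exp_⋆ ψ` on a dual semigroup. -/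
noncomputable def convExp (hσ : P.IsSymbol σ) (ψ : B →ₗ[ℂ] ℂ) : B →ₗ[ℂ] ℂ :=
  hσ.isCoalgebra.convExp (symDeriv ψ) ∘ₗ SymmetricAlgebra.ι ℂ B

theorem isConvExp_iff (hσ : P.IsSymbol σ) (ψ φ : B →ₗ[ℂ] ℂ) :
    P.IsConvExp ψ φ ↔ φ = hσ.convExp ψ := by
  constructor
  · rintro ⟨τ, hτ, h⟩
    obtain rfl := hσ.unique hτ
    ext b
    exact (h b).unique (hσ.isCoalgebra.hasTensorConvExpAt_convExp _ _)
  · rintro rfl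
    exact ⟨σ, hσ, fun b => hσ.isCoalgebra.hasTensorConvExpAt_convExp _ _⟩

theorem tendsto_convPow (hσ : P.IsSymbol σ) (ψ : B →ₗ[ℂ] ℂ) {χ : ℕ → B →ₗ[ℂ] ℂ}
    (hχ : ∀ v, Tendsto (fun n : ℕ => (n : ℂ) * χ n v) atTop (𝓝 (ψ v))) (b : B) :
    Tendsto (fun n : ℕ => P.convPow (χ n) n b) atTop (𝓝 (hσ.convExp ψ b)) := by
  have h := hσ.tendsto_lift_convPow ψ hχ (SymmetricAlgebra.ι ℂ B b)
  simp only [SymmetricAlgebra.lift_ι_apply] at h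
  exact h

/-- By the limit theorem with $\chi_n=\psi/n$, the exponential on $S(B)$ is a pointwise limit of the
unital homomorphisms $S(\chi_n^{\star n})$. It is thus itself multiplicative and determined by its
restriction to $B$. -/
theorem lift_convExp (hσ : P.IsSymbol σ) (ψ : B →ₗ[ℂ] ℂ) :
    (SymmetricAlgebra.lift (hσ.convExp ψ)).toLinearMap =
      hσ.isCoalgebra.convExp (symDeriv ψ) := by
  have hχ : ∀ v, Tendsto (fun n : ℕ => (n : ℂ) * ((n : ℂ)⁻¹ • ψ) v) atTop (𝓝 (ψ v)) := by
    intro v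
    refine tendsto_const_nhds.congr' ?_
    filter_upwards [eventually_gt_atTop 0] with n hn
    have hn' : (n : ℂ) ≠ 0 := by exact_mod_cast hn.ne'
    simp [hn']
  have h := hσ.tendsto_lift_convPow ψ hχ
  ext x
  rw [AlgHom.toLinearMap_apply]
  induction x using SymmetricAlgebra.induction with
  | algebraMap r =>
    refine tendsto_nhds_unique ?_ (h _)
    simp only [AlgHom.commutes]
    exact tendsto_const_nhds
  | ι v => rw [SymmetricAlgebra.lift_ι_apply]; rfl
  | add x y hx hy => rw [map_add, map_add, hx, hy]
  | mul x y hx hy =>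
    rw [map_mul, hx, hy]
    refine tendsto_nhds_unique ((h x).mul (h y)) ?_
    simpa only [map_mul] using h (x * y)

theorem convExp_smul_apply (hσ : P.IsSymbol σ) (t : ℝ) (ψ : B →ₗ[ℂ] ℂ) (b : B) :
    hσ.convExp ((t : ℂ) • ψ) b =
      hσ.isCoalgebra.convExp ((t : ℂ) • symDeriv ψ) (SymmetricAlgebra.ι ℂ B b) := by
  rw [convExp, symDeriv_ofReal_smul, LinearMap.comp_apply]

theorem isCCSG (hσ : P.IsSymbol σ) (ψ : B →ₗ[ℂ] ℂ) :
    P.IsCCSG fun t : ℝ≥0 => hσ.convExp (((t : ℝ) : ℂ) • ψ) where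
  add s t := by
    ext b
    have h := hσ.isCoalgebra.convExp_add_smul ((s : ℝ) : ℂ) ((t : ℝ) : ℂ) (symDeriv ψ)
    -- Both exponentials have the form $S(\varphi)$, so their convolution on $S(B)$ restricts to
    -- $\varphi_s\star\varphi_t$ on $B$.
    rw [← symDeriv_ofReal_smul, ← symDeriv_ofReal_smul, ← hσ.lift_convExp, ← hσ.lift_convExp,
      hσ.tensorConv_lift] at h
    have h2 := LinearMap.congr_fun h (SymmetricAlgebra.ι ℂ B b)
    rw [AlgHom.toLinearMap_apply, SymmetricAlgebra.lift_ι_apply] at h2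
    rw [convExp_smul_apply, ← h2]
    simp
  zero := by
    ext b
    rw [convExp_smul_apply]
    simp [IsCoalgebra.convExp_zero]
  tendsto b := by
    have h := hσ.isCoalgebra.tendsto_convExp_smul (symDeriv ψ) (SymmetricAlgebra.ι ℂ B b)
    rw [AlgHom.toLinearMap_apply, SymmetricAlgebra.lift_ι_apply, LinearMap.zero_apply] at h
    simp only [convExp_smul_apply]
    refine h.comp (Tendsto.mono_left ?_ nhdsWithin_le_nhds)
    have hc : Continuous fun t : ℝ≥0 => ((t : ℝ) : ℂ) := by fun_prop
    simpa using hc.tendsto 0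

/-- `n φ_{t/n} → t ψ` pointwise for `φ_t = exp_⋆(t ψ)`. -/
theorem tendsto_nsmul_convExp (hσ : P.IsSymbol σ) (t : ℝ) (ψ : B →ₗ[ℂ] ℂ) (b : B) :
    Tendsto (fun n : ℕ => (n : ℂ) * hσ.convExp (((t / n : ℝ) : ℂ) • ψ) b) atTop
      (𝓝 ((t : ℂ) * ψ b)) := by
  have h := hσ.isCoalgebra.tendsto_nsmul_convExp_sub ((t : ℂ) • symDeriv ψ)
    (SymmetricAlgebra.ι ℂ B b)
  rw [AlgHom.toLinearMap_apply, SymmetricAlgebra.lift_ι_apply, LinearMap.zero_apply,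
    LinearMap.smul_apply, symDeriv_ι, smul_eq_mul] at h
  refine h.congr fun n => ?_
  rw [sub_zero, convExp_smul_apply, smul_smul]
  congr 4
  push_cast
  ring

end IsSymbol

end Independence

/-! ## States -/

section States

variable {A : Type u} [NonUnitalRing A] [Module ℂ A] [StarRing A]

theorem isState_zero : IsState (0 : A →ₗ[ℂ] ℂ) := by
  intro x
  simp only [unitExt, LinearMap.zero_apply, add_zero, Unitization.fst_mul, Unitization.fst_star]
  exact star_mul_self_nonneg x.fst

theorem IsState.of_tendsto {φ : ℕ → A →ₗ[ℂ] ℂ} {ψ : A →ₗ[ℂ] ℂ} (hφ : ∀ n, IsState (φ n))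
    (h : ∀ a, Tendsto (fun n => φ n a) atTop (𝓝 (ψ a))) : IsState ψ :=
  fun _ => ge_of_tendsto' ((h _).const_add _) fun n => hφ n _

theorem IsCondPositive.smul {ψ : A →ₗ[ℂ] ℂ} (hψ : IsCondPositive ψ) {t : ℝ} (ht : 0 ≤ t) :
    IsCondPositive ((t : ℂ) • ψ) := by
  refine ⟨fun a => ?_, fun a => ?_⟩
  · simp [hψ.1 a]
  · have ht' : (0 : ℂ) ≤ t := by exact_mod_cast ht
    exact mul_nonneg ht' (hψ.2 a)

variable [IsScalarTower ℂ A A] [SMulCommClass ℂ A A]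

theorem IsState.comp {B : Type u} [NonUnitalRing B] [Module ℂ B] [IsScalarTower ℂ B B]
    [SMulCommClass ℂ B B] [StarRing B] [StarModule ℂ B] {φ : B →ₗ[ℂ] ℂ} (hφ : IsState φ)
    (κ : A →⋆ₙₐ[ℂ] B) : IsState (φ ∘ₗ (κ.toNonUnitalAlgHom : A →ₗ[ℂ] B)) := by
  intro x
  have h1 : ∀ y : Unitization ℂ A, unitExt (φ ∘ₗ (κ.toNonUnitalAlgHom : A →ₗ[ℂ] B)) y =
      unitExt φ (Unitization.starMap κ y) := by
    intro y
    induction y using Unitization.ind with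
    | inl_add_inr r a =>
      rw [map_add, Unitization.starMap_inl, Unitization.starMap_inr,
        Unitization.algebraMap_eq_inl]
      simp [unitExt]
  rw [h1, map_mul, map_star]
  exact hφ _

theorem Independence.IsPositive.isState_convPow [StarModule ℂ A] [DualSemigroup A] {P : Independence.{u}}
    (hP : P.IsPositive) {φ : A →ₗ[ℂ] ℂ} (hφ : IsState φ) (n : ℕ) : IsState (P.convPow φ n) := by
  induction n with
  | zero => exact isState_zero
  | succ n ih => exact (hP _ _ ih hφ).comp DualSemigroup.comul

end States

/-! ### Transport of the Schoenberg correspondence along a homomorphism -/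

theorem mainTheorem5 {B C : Type u}
    [NonUnitalRing B] [Module ℂ B] [IsScalarTower ℂ B B] [SMulCommClass ℂ B B]
    [StarRing B] [StarModule ℂ B] [DualSemigroup B]
    [NonUnitalRing C] [Module ℂ C] [IsScalarTower ℂ C C] [SMulCommClass ℂ C C]
    [StarRing C] [StarModule ℂ C] [DualSemigroup C]
    (κ : C →⋆ₙₐ[ℂ] B) (hB : SchoenbergHolds B)
    (ψ : B →ₗ[ℂ] ℂ) (hψ : IsCondPositive ψ)
    (P : Independence.{u}) (hP : P.IsPositive) :
    ∃ φ : ℝ≥0 → (C →ₗ[ℂ] ℂ),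
      (∀ (t : ℝ≥0) (f : C →ₗ[ℂ] ℂ),
        P.IsConvExp (((t : ℝ) : ℂ) • (ψ ∘ₗ (κ.toNonUnitalAlgHom : C →ₗ[ℂ] B))) f ↔ f = φ t) ∧
      P.IsCCSG φ ∧
      ∀ t, IsState (φ t) := by
  obtain ⟨σ, hσ⟩ := P.exists_isSymbol C C
  obtain ⟨τ, hτ⟩ := P.exists_isSymbol B B
  refine ⟨fun t => hσ.convExp (((t : ℝ) : ℂ) • (ψ ∘ₗ (κ.toNonUnitalAlgHom : C →ₗ[ℂ] B))),
    fun t f => hσ.isConvExp_iff _ f, hσ.isCCSG _, fun t => ?_⟩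
  -- The exponential is taken in $\mathcal B$, where positivity is known, and only then pulled back.
  -- At $n=0$ the quotient $t/0=0$ keeps the coefficient nonnegative.
  let χ : ℕ → C →ₗ[ℂ] ℂ := fun n =>
    hτ.convExp ((((t : ℝ) / n : ℝ) : ℂ) • ψ) ∘ₗ (κ.toNonUnitalAlgHom : C →ₗ[ℂ] B)
  have hχ : ∀ n, IsState (χ n) := fun n =>
    IsState.comp (hB P hP _ (hψ.smul (by positivity)) _ ((hτ.isConvExp_iff _ _).2 rfl)) κ
  -- Positivity of the independence makes the powers $\chi_n^{\star n}$ states on $\mathcal C$, and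
  -- states are closed under pointwise limits.
  exact IsState.of_tendsto (fun n => hP.isState_convPow (hχ n) n)
    (hσ.tendsto_convPow _ fun c => hτ.tendsto_nsmul_convExp t ψ (κ c))
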